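/- Graphs are finite and may have loops and parallel edges; a loop counts twice in the degree of its vertex. A set $B$ of edges of a graph $G$ is \emph{cycle-separating} if $G-B$ is disconnected and at least two of its components contain cycles (a loop and a pair of parallel edges are cycles of length $1$ and $2$). A connected graph is \emph{cyclically $4$-edge-connected} if no set of fewer than $4$ edges is cycle-separating. A set of vertices is \emph{decycling} if its removal leaves an acyclic graph, \emph{independent} if it induces no edge, and \emph{near-independent} if it induces exactly one edge. A \emph{stable decycling partition} of $G$ is a partition $\{A,J\}$ of $V(G)$ into two nonempty sets such that $J$ is a decycling set of minimum size, $J$ is independent or near-independent, and $A$ induces a forest with at most two components; it is \emph{coherent} if $A$ induces a tree. Theorem. Every cyclically $4$-edge-connected cubic graph $G$ has a coherent stable decycling partition. More precisely, if $G$ has $n$ vertices, then $V(G)$ has a coherent stable decycling partition $\{A,J\}$ (so that $A$ induces a tree) for which $J$ is independent if and only if $n\equiv 2\pmod 4$, and near-independent if and only if $n\equiv 0\pmod 4$. -/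

import Mathlib

/-!
Graphs are Mathlib's multigraphs `Graph α β`: loops and parallel edges are allowed.
`V(G)` is the vertex set and `E(G)` the edge set.
-/

namespace Graph

variable {α β : Type*}

/-- The degree of `v`: the number of edges incident with `v`, each loop counted twice. -/
noncomputable def degree (G : Graph α β) (v : α) : ℕ∞ :=
  (G.incidenceSet v).encard + (G.loopSet v).encard

/-- A cubic graph: every vertex has degree three. -/
def IsCubic (G : Graph α β) : Prop :=
  ∀ v ∈ V(G), G.degree v = 3

/-- A connected graph: nonempty, and any two vertices are joined by a walk. -/
def IsConnected (G : Graph α β) : Prop :=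
  V(G).Nonempty ∧ ∀ x ∈ V(G), ∀ y ∈ V(G), Relation.ReflTransGen G.Adj x y

/-- `H` is a connected component of `G`: a connected subgraph that contains every edge of `G`
incident with one of its vertices. -/
def IsComponentOf (H G : Graph α β) : Prop :=
  H ≤c G ∧ H.IsConnected

/-- A cycle: a finite connected graph in which every vertex has degree two. A vertex with a loop,
and a pair of parallel edges, are cycles of length one and two. -/
def IsCycle (C : Graph α β) : Prop :=
  V(C).Finite ∧ C.IsConnected ∧ ∀ v ∈ V(C), C.degree v = 2

/-- `G` contains a cycle as a subgraph. -/
def HasCycle (G : Graph α β) : Prop :=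
  ∃ C : Graph α β, C ≤ G ∧ C.IsCycle

/-- A tree: a connected graph without cycles. -/
def IsTree (G : Graph α β) : Prop :=
  G.IsConnected ∧ ¬ G.HasCycle

/-- A set `B` of edges of `G` is cycle-separating if `G - B` is disconnected and at least two of
its components contain cycles. -/
def IsCycleSeparating (G : Graph α β) (B : Set β) : Prop :=
  B ⊆ E(G) ∧ ¬ (G.deleteEdges B).IsConnected ∧
    ∃ H₁ H₂ : Graph α β, H₁ ≠ H₂ ∧
      H₁.IsComponentOf (G.deleteEdges B) ∧ H₂.IsComponentOf (G.deleteEdges B) ∧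
      H₁.HasCycle ∧ H₂.HasCycle

/-- A connected graph is cyclically `k`-edge-connected if no set of fewer than `k` edges is
cycle-separating. -/
def IsCyclicallyEdgeConnected (G : Graph α β) (k : ℕ) : Prop :=
  G.IsConnected ∧ ∀ B : Set β, B.encard < k → ¬ G.IsCycleSeparating B

/-- A set `J` of vertices is independent if it induces no edge. -/
def IsIndependent (G : Graph α β) (J : Set α) : Prop :=
  E(G.induce J) = ∅

/-- A set `J` of vertices is near-independent if it induces exactly one edge. -/
def IsNearIndependent (G : Graph α β) (J : Set α) : Prop :=
  E(G.induce J).encard = 1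

/-- A set `J` of vertices is decycling if its removal leaves a graph without cycles. -/
def IsDecycling (G : Graph α β) (J : Set α) : Prop :=
  J ⊆ V(G) ∧ ¬ (G.deleteVerts J).HasCycle

/-- A decycling set of the smallest possible size. -/
def IsMinimumDecycling (G : Graph α β) (J : Set α) : Prop :=
  G.IsDecycling J ∧ ∀ K : Set α, G.IsDecycling K → J.encard ≤ K.encard

/-- `{A, J}` is a stable decycling partition of `G`: `A` and `J` partition the vertex set, `J` is a
minimum decycling set which is independent or near-independent, and `A` induces a forest with at
most two components. -/
structure IsStableDecyclingPartition (G : Graph α β) (A J : Set α) : Prop where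
  union_eq : A ∪ J = V(G)
  disjoint : Disjoint A J
  nonempty_left : A.Nonempty
  nonempty_right : J.Nonempty
  minimum_decycling : G.IsMinimumDecycling J
  independent_or_near : G.IsIndependent J ∨ G.IsNearIndependent J
  forest : ¬ (G.induce A).HasCycle
  components : {H : Graph α β | H.IsComponentOf (G.induce A)}.encard ≤ 2

/-- A stable decycling partition `{A, J}` is coherent if `A` induces a tree. -/
def IsCoherentDecyclingPartition (G : Graph α β) (A J : Set α) : Prop :=
  G.IsStableDecyclingPartition A J ∧ (G.induce A).IsTree

end Graph

/-!
The complement of the required tree is found as follows. In a cubic graph, an independent set `J` of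
vertices whose removal leaves a connected graph consists of leaves of a spanning tree `T`, and each
vertex of `J` lies on two edges outside `T`. If all edges outside `T` are used up in this way, then
`J` leaves a tree. So one looks for a spanning tree whose complement splits into pairs of adjacent
edges, that is, whose complement has only components of even size. By a theorem of Nebeský on upper
embeddable graphs, there is one if and only if for every partition of the vertex set the
number of parts plus the number of parts with odd cyclomatic number exceeds the number of edges
between the parts by at most one. This condition is `LooplessMultigraph.Balanced`. In its statement
each part `D` has as its weight the least integer above `e(D)` of the same parity as `#D`, which
makes parity arguments immediate and avoids all reference to components.

The sufficiency of the condition for graphs of maximum degree three is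
`LooplessMultigraph.Balanced.exists_isTreeComplement`. The proof follows the pattern of the proof of
Tutte's matching theorem from a maximal barrier. Take a partition with equality and as many parts
as possible. Each part either is a single vertex, or has odd cyclomatic number and becomes
balanced when any vertex with an edge to another part is removed from it, so induction applies
to the rest of the part. It remains to choose a spanning tree of the graph of parts whose complement
leaves each odd part a private edge; its end in the part joins `J`. This is
`exists_connecting_with_spare`, an application of Hall's theorem. If the partition has only one
part, any vertex may be put into `J` and removed.

In a cyclically 4-edge-connected cubic graph every edge cut has at least three edges, and at least
four unless it separates a single vertex, because a side that induces a forest on `k` vertices is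
left by at least `k + 2` edges. Summing over the parts shows that the whole graph is balanced if `n
≡ 2 [MOD 4]`, and that the graph minus any two adjacent vertices is balanced if `n ≡ 0 [MOD 4]`. In
the second case the two vertices are added to `J`, which then induces only the edge between them.
Counting edges shows that a decycling set has at least `(n + 2) / 4` vertices, so the sets obtained
are of minimum size.
-/

set_option linter.unusedSectionVars false

open Finset

/-! ### Finite loopless multigraphs -/

/-- A loopless multigraph with finitely many edges: each edge has a two-element set of ends. The
vertex set is left implicit; induced subgraphs are given by finite sets of vertices. -/
structure LooplessMultigraph (V ε : Type*) where
  /-- The edges. -/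
  edges : Finset ε
  /-- The set of ends of an edge (a junk value outside `edges`). -/
  ends : ε → Finset V
  card_ends : ∀ e ∈ edges, #(ends e) = 2

/-! ### Operations on finite partitions -/

/-- A finite partition of `A` and one of a disjoint set `B` combine to one of `A ∪ B`. -/
lemma Finpartition.exists_union {V : Type*} [DecidableEq V] {A B C : Finset V}
    (P : Finpartition A) (Q : Finpartition B) (hAB : Disjoint A B) (hC : A ∪ B = C) :
    ∃ R : Finpartition C, #R.parts = #P.parts + #Q.parts ∧
      ∀ f : Finset V → ℕ, ∑ D ∈ R.parts, f D = ∑ D ∈ P.parts, f D + ∑ D ∈ Q.parts, f D := by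
  have hd : Disjoint P.parts Q.parts := by
    rw [Finset.disjoint_left]
    intro D hP hQ
    obtain ⟨x, hx⟩ := P.nonempty_of_mem_parts hP
    exact Finset.disjoint_left.1 hAB (P.subset hP hx) (Q.subset hQ hx)
  let R : Finpartition C :=
    { parts := P.parts ∪ Q.parts
      supIndep := by
        rw [Finset.supIndep_iff_pairwiseDisjoint]
        intro X hX Y hY hXY
        simp only [coe_union, Set.mem_union, mem_coe] at hX hY
        rcases hX with hX | hX <;> rcases hY with hY | hY
        · exact P.disjoint hX hY hXY
        · exact hAB.mono (P.subset hX) (Q.subset hY)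
        · exact (hAB.mono (P.subset hY) (Q.subset hX)).symm
        · exact Q.disjoint hX hY hXY
      sup_parts := by
        rw [Finset.sup_union, P.sup_parts, Q.sup_parts]; exact hC
      bot_notMem := by
        simp only [mem_union, not_or]
        exact ⟨P.bot_notMem, Q.bot_notMem⟩ }
  exact ⟨R, Finset.card_union_of_disjoint hd, fun f => Finset.sum_union hd⟩

/-- A part of a finite partition may be refined by a partition of it. -/
lemma Finpartition.exists_refine {V : Type*} [DecidableEq V] {W D : Finset V}
    (P : Finpartition W) (hD : D ∈ P.parts) (Q : Finpartition D) :
    ∃ R : Finpartition W, #R.parts + 1 = #P.parts + #Q.parts ∧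
      ∀ f : Finset V → ℕ, ∑ X ∈ R.parts, f X + f D = ∑ X ∈ P.parts, f X + ∑ X ∈ Q.parts, f X := by
  have hdis : Disjoint ((P.parts.erase D).sup id) D := by
    have := P.supIndep (Finset.erase_subset D P.parts) hD (Finset.notMem_erase D _)
    exact this.symm
  have hun : (P.parts.erase D).sup id ∪ D = W := by
    have h1 : (insert D (P.parts.erase D)).sup id = W := by
      rw [Finset.insert_erase hD, P.sup_parts]
    rw [Finset.sup_insert] at h1
    rw [Finset.union_comm]; exact h1
  let P' : Finpartition ((P.parts.erase D).sup id) := P.ofSubset (Finset.erase_subset _ _) rfl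
  obtain ⟨R, hc, hf⟩ := P'.exists_union Q hdis hun
  refine ⟨R, ?_, fun f => ?_⟩
  · have : #P'.parts + 1 = #P.parts := Finset.card_erase_add_one hD
    omega
  · have h1 : ∑ X ∈ P'.parts, f X + f D = ∑ X ∈ P.parts, f X := Finset.sum_erase_add _ _ hD
    have := hf f
    omega

/-- Some of the parts of a finite partition may be merged into one. -/
lemma Finpartition.exists_merge {V : Type*} [DecidableEq V] {W : Finset V}
    (P : Finpartition W) {X : Finset (Finset V)} (hX : X ⊆ P.parts) (hne : X.Nonempty) :
    ∃ R : Finpartition W, ∀ f : Finset V → ℕ,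
      ∑ D ∈ R.parts, f D + ∑ D ∈ X, f D = ∑ D ∈ P.parts, f D + f (X.sup id) := by
  have hdis : Disjoint ((P.parts \ X).sup id) (X.sup id) := by
    rw [Finset.disjoint_sup_left]
    intro D hD
    rw [Finset.disjoint_sup_right]
    intro D' hD'
    rw [mem_sdiff] at hD
    exact P.disjoint hD.1 (hX hD') (fun h => hD.2 (h ▸ hD'))
  have hun : (P.parts \ X).sup id ∪ X.sup id = W := by
    have h1 : ((P.parts \ X) ∪ X).sup id = W := by
      rw [Finset.sdiff_union_of_subset hX, P.sup_parts]
    rw [Finset.sup_union] at h1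
    exact h1
  have hne' : X.sup id ≠ ⊥ := by
    obtain ⟨D, hD⟩ := hne
    obtain ⟨v, hv⟩ := P.nonempty_of_mem_parts (hX hD)
    intro h
    have : v ∈ X.sup id := Finset.mem_sup.2 ⟨D, hD, hv⟩
    rw [h] at this
    exact Finset.notMem_empty _ this
  let P' : Finpartition ((P.parts \ X).sup id) := P.ofSubset Finset.sdiff_subset rfl
  obtain ⟨R, -, hf⟩ := P'.exists_union (Finpartition.indiscrete hne') hdis hun
  refine ⟨R, fun f => ?_⟩
  have h1 : ∑ D ∈ P'.parts, f D + ∑ D ∈ X, f D = ∑ D ∈ P.parts, f D := Finset.sum_sdiff hX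
  have h2 : ∑ D ∈ (Finpartition.indiscrete hne').parts, f D = f (X.sup id) :=
    Finset.sum_singleton _ _
  have := hf f
  omega

/-! ### Connecting edges of a hypergraph with private spare edges -/

/-- Let each edge `e ∈ C` of a hypergraph on the nodes `N` have the set of ends `I e`. If the number
of edges is `|N| + |O| - 1`, and every nonempty set `X` of nodes spans at most `|X| + |X ∩ O| - 1`
edges, then some set `K` of edges connects all nodes while each node of `O` is left with a private
edge outside `K`. Hall's theorem orients the edges so that every node has one entering edge, and a
second one if it is in `O`, except that a chosen root has one less. The count shows that each
set avoiding the root is entered by an edge from outside, so an arborescence can be grown. -/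
lemma exists_connecting_with_spare {ν ε : Type*} [DecidableEq ν] [DecidableEq ε] [Nonempty ε]
    (N O : Finset ν) (C : Finset ε) (I : ε → Finset ν) (r : ν) (hr : r ∈ N) (hO : O ⊆ N)
    (hI : ∀ e ∈ C, I e ⊆ N) (hIne : ∀ e ∈ C, (I e).Nonempty)
    (hcard : #C + 1 = #N + #O)
    (hspan : ∀ X ⊆ N, X.Nonempty → #{e ∈ C | I e ⊆ X} + 1 ≤ #X + #(X ∩ O)) :
    ∃ (K : Finset ε) (s : ν → ε), K ⊆ C ∧ (∀ D ∈ O, s D ∈ C ∧ s D ∉ K ∧ D ∈ I (s D)) ∧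
      Set.InjOn s O ∧
      ∀ Y ⊆ N, Y.Nonempty → (∀ e ∈ K, ¬ Disjoint (I e) Y → I e ⊆ Y) → Y = N := by
  -- The token `(D, false)` stands for a tree edge entering `D`, the token `(D, true)` for a spare.
  set T : Finset (ν × Bool) := (N.erase r) ×ˢ {false} ∪ O ×ˢ {true} with hT
  have hTfilter : ∀ X ⊆ N, #{p ∈ T | p.1 ∈ X} = #(X.erase r) + #(X ∩ O) := by
    intro X hX
    have h1 : {p ∈ T | p.1 ∈ X} = (X.erase r) ×ˢ {false} ∪ (X ∩ O) ×ˢ {true} := by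
      ext ⟨a, b⟩
      have := @hX a
      simp only [hT, mem_filter, mem_union, mem_product, mem_erase, mem_singleton, mem_inter]
      tauto
    rw [h1, Finset.card_union_of_disjoint, Finset.card_product, Finset.card_product]
    · simp
    · rw [Finset.disjoint_left]
      rintro ⟨a, b⟩ h h'
      simp only [mem_product, mem_singleton] at h h'
      rw [h.2] at h'
      exact absurd h'.2 (by simp)
  have hTcard : #T = #C := by
    have h1 := hTfilter N subset_rfl
    have h2 : {p ∈ T | p.1 ∈ N} = T := by
      apply Finset.filter_true_of_mem
      rintro ⟨a, b⟩ h
      simp only [hT, mem_union, mem_product, mem_erase] at h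
      rcases h with h | h
      · exact h.1.2
      · exact hO h.1
    rw [h2, Finset.inter_eq_right.2 hO] at h1
    have := Finset.card_erase_add_one hr
    omega
  have hall : ∀ S : Finset {e // e ∈ C},
      #S ≤ #(S.biUnion fun e => {p ∈ T | p.1 ∈ I e.1}) := by
    intro S
    rcases S.eq_empty_or_nonempty with rfl | hS
    · simp
    set X := S.biUnion fun e => I e.1 with hX
    have hXP : X ⊆ N := Finset.biUnion_subset.2 fun e _ => hI e.1 e.2
    have hXne : X.Nonempty := by
      obtain ⟨e, he⟩ := hS
      obtain ⟨D, hD⟩ := hIne e.1 e.2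
      exact ⟨D, Finset.mem_biUnion.2 ⟨e, he, hD⟩⟩
    have h1 : (S.biUnion fun e => {p ∈ T | p.1 ∈ I e.1}) = {p ∈ T | p.1 ∈ X} := by
      ext p
      simp only [mem_biUnion, mem_filter, hX]
      constructor
      · rintro ⟨e, he, hp, hpe⟩
        exact ⟨hp, e, he, hpe⟩
      · rintro ⟨hp, e, he, hpe⟩
        exact ⟨e, he, hp, hpe⟩
    have h2 : #S ≤ #{e ∈ C | I e ⊆ X} := by
      refine Finset.card_le_card_of_injOn (fun e => e.1) ?_ (fun a _ b _ h => Subtype.ext h)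
      intro e he
      simp only [coe_filter, Set.mem_ofPred_eq]
      exact ⟨e.2, Finset.subset_biUnion_of_mem (fun e : {e // e ∈ C} => I e.1) he⟩
    have h3 := hspan X hXP hXne
    have h4 := Finset.pred_card_le_card_erase (s := X) (a := r)
    rw [h1, hTfilter X hXP]
    omega
  obtain ⟨f, hfinj, hf⟩ := (Finset.all_card_le_biUnion_card_iff_exists_injective _).1 hall
  have hsurj : ∀ p ∈ T, ∃ e : {e // e ∈ C}, f e = p := by
    have h1 : Finset.univ.image f ⊆ T := by
      intro p hp
      obtain ⟨e, -, rfl⟩ := Finset.mem_image.1 hp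
      exact (Finset.mem_filter.1 (hf e)).1
    have h2 : Finset.univ.image f = T := by
      apply Finset.eq_of_subset_of_card_le h1
      rw [Finset.card_image_of_injective _ hfinj, hTcard]
      simp
    intro p hp
    rw [← h2] at hp
    obtain ⟨e, -, he⟩ := Finset.mem_image.1 hp
    exact ⟨e, he⟩
  have hfI : ∀ e, (f e).1 ∈ I e.1 := fun e => (Finset.mem_filter.1 (hf e)).2
  -- Every proper set of nodes containing the root is left by an edge directed out of it.
  have hstep : ∀ Z ⊆ N, r ∈ Z → Z ≠ N → ∃ e, (f e).1 ∉ Z ∧ ¬ Disjoint (I e.1) Z := by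
    intro Z hZ hrZ hne
    by_contra! hcon
    have hYne : (N \ Z).Nonempty := by
      rw [Finset.sdiff_nonempty]
      exact fun h => hne (hZ.antisymm h)
    have h1 := hspan (N \ Z) Finset.sdiff_subset hYne
    have h2 := hTfilter (N \ Z) Finset.sdiff_subset
    rw [Finset.erase_eq_of_notMem (by simp [hrZ])] at h2
    have h3 : #{p ∈ T | p.1 ∈ N \ Z} ≤ #{e ∈ C | I e ⊆ N \ Z} := by
      have hsub : {p ∈ T | p.1 ∈ N \ Z} ⊆
          (Finset.univ.filter fun e : {e // e ∈ C} => I e.1 ⊆ N \ Z).image f := by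
        intro p hp
        obtain ⟨hpT, hpZ⟩ := Finset.mem_filter.1 hp
        obtain ⟨e, rfl⟩ := hsurj p hpT
        refine Finset.mem_image.2 ⟨e, Finset.mem_filter.2 ⟨Finset.mem_univ _, ?_⟩, rfl⟩
        have hd := hcon e (Finset.mem_sdiff.1 hpZ).2
        intro D hD
        exact Finset.mem_sdiff.2 ⟨hI e.1 e.2 hD, Finset.disjoint_left.1 hd hD⟩
      refine (Finset.card_le_card hsub).trans (Finset.card_image_le.trans ?_)
      refine Finset.card_le_card_of_injOn (fun e => e.1) ?_ (fun a _ b _ h => Subtype.ext h)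
      intro e he
      simp only [coe_filter, Set.mem_ofPred_eq, mem_univ, true_and] at he ⊢
      exact ⟨e.2, he⟩
    omega
  have hgrow : ∀ n : ℕ, ∀ Z ⊆ N, r ∈ Z → #(N \ Z) = n → ∀ K : Finset {e // e ∈ C},
      Set.InjOn (fun e => (f e).1) K → (∀ e ∈ K, (f e).1 ∈ Z ∧ (f e).1 ≠ r) →
      (∀ Y, r ∈ Y → (∀ e ∈ K, ¬ Disjoint (I e.1) Y → I e.1 ⊆ Y) → Z ⊆ Y) →
      ∃ K : Finset {e // e ∈ C}, Set.InjOn (fun e => (f e).1) K ∧ (∀ e ∈ K, (f e).1 ≠ r) ∧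
        ∀ Y, r ∈ Y → (∀ e ∈ K, ¬ Disjoint (I e.1) Y → I e.1 ⊆ Y) → N ⊆ Y := by
    intro n
    induction n with
    | zero =>
      intro Z hZ hrZ hn K hinj hK hY
      rw [Finset.card_eq_zero, Finset.sdiff_eq_empty_iff_subset] at hn
      exact ⟨K, hinj, fun e he => (hK e he).2, fun Y h1 h2 => hn.trans (hY Y h1 h2)⟩
    | succ n ih =>
      intro Z hZ hrZ hn K hinj hK hY
      have hne : Z ≠ N := by
        rintro rfl
        simp at hn
      obtain ⟨e, heZ, hed⟩ := hstep Z hZ hrZ hne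
      have heP : (f e).1 ∈ N := hI e.1 e.2 (hfI e)
      refine ih (insert (f e).1 Z) (Finset.insert_subset heP hZ) (Finset.mem_insert_of_mem hrZ) ?_
        (insert e K) ?_ ?_ ?_
      · have : N \ insert (f e).1 Z = (N \ Z).erase (f e).1 := by
          ext D
          simp only [mem_sdiff, mem_insert, mem_erase]
          tauto
        rw [this, Finset.card_erase_of_mem (Finset.mem_sdiff.2 ⟨heP, heZ⟩), hn]
        rfl
      · rw [Finset.coe_insert]
        by_cases heK : e ∈ K
        · rwa [Set.insert_eq_of_mem (Finset.mem_coe.2 heK)]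
        · rw [Set.injOn_insert (by simpa using heK)]
          refine ⟨hinj, ?_⟩
          rintro ⟨e', he', h⟩
          have h' : (f e').1 = (f e).1 := h
          exact heZ (h' ▸ (hK e' he').1)
      · intro e' he'
        rcases Finset.mem_insert.1 he' with rfl | he'
        · exact ⟨Finset.mem_insert_self _ _, fun h => heZ (h ▸ hrZ)⟩
        · exact ⟨Finset.mem_insert_of_mem (hK e' he').1, (hK e' he').2⟩
      · intro Y hrY hclosed
        have hZY := hY Y hrY fun e' he' => hclosed e' (Finset.mem_insert_of_mem he')
        refine Finset.insert_subset ?_ hZY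
        exact hclosed e (Finset.mem_insert_self _ _) (fun h => hed (h.mono_right hZY)) (hfI e)
  obtain ⟨K, hKinj, hKr, hKY⟩ := hgrow _ {r} (Finset.singleton_subset_iff.2 hr)
    (Finset.mem_singleton_self r) rfl ∅ (by simp) (by simp)
    (fun Y h _ => Finset.singleton_subset_iff.2 h)
  have hspare : ∀ D ∈ O, ∃ e : ε, ∃ he : e ∈ C, ⟨e, he⟩ ∉ K ∧ (f ⟨e, he⟩).1 = D := by
    intro D hD
    obtain ⟨⟨e₁, hC₁⟩, he₁⟩ := hsurj (D, true) (by simp [hT, hD])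
    by_cases hDr : D = r
    · exact ⟨e₁, hC₁, fun h => hKr _ h (by rw [he₁, hDr]), by rw [he₁]⟩
    obtain ⟨⟨e₂, hC₂⟩, he₂⟩ := hsurj (D, false) (by simp [hT, hO hD, hDr])
    by_cases h₁ : ⟨e₁, hC₁⟩ ∈ K
    · refine ⟨e₂, hC₂, fun h₂ => ?_, by rw [he₂]⟩
      have h : (⟨e₁, hC₁⟩ : {e // e ∈ C}) = ⟨e₂, hC₂⟩ := hKinj h₁ h₂ (by simp only [he₁, he₂])
      rw [h, he₂] at he₁
      simp at he₁
    · exact ⟨e₁, hC₁, h₁, by rw [he₁]⟩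
  choose! s hs using hspare
  have hmemK : ∀ e (he : e ∈ C), e ∈ K.map (Function.Embedding.subtype _) ↔ ⟨e, he⟩ ∈ K := by
    intro e he
    simp [he]
  refine ⟨K.map (Function.Embedding.subtype _), s, ?_, ?_, ?_, ?_⟩
  · intro e he
    obtain ⟨e', -, rfl⟩ := Finset.mem_map.1 he
    exact e'.2
  · intro D hD
    obtain ⟨hC, hK, hh⟩ := hs D hD
    refine ⟨hC, fun h => hK ((hmemK _ hC).1 h), ?_⟩
    have := hfI ⟨s D, hC⟩
    rwa [hh] at this
  · intro D hD D' hD' h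
    obtain ⟨hC, -, hh⟩ := hs D hD
    obtain ⟨hC', -, hh'⟩ := hs D' hD'
    rw [← hh, ← hh']
    simp only [h]
  · intro Y hY hYne hclosed
    have hcl : ∀ e ∈ K, ¬ Disjoint (I e.1) Y → I e.1 ⊆ Y := fun e he =>
      hclosed e.1 ((hmemK _ e.2).2 he)
    by_cases hrY : r ∈ Y
    · exact hY.antisymm (hKY Y hrY hcl)
    -- Otherwise the complement of `Y` is closed as well, and contains the root.
    · exfalso
      obtain ⟨D, hD⟩ := hYne
      have h := hKY (N \ Y) (Finset.mem_sdiff.2 ⟨hr, hrY⟩) (fun e he hd => ?_) (hY hD)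
      · exact (Finset.mem_sdiff.1 h).2 hD
      · rw [Finset.subset_sdiff]
        refine ⟨hI e.1 e.2, ?_⟩
        by_contra hcon
        have hsub := hcl e he hcon
        exact hd (Finset.disjoint_left.2 fun x hx hx' => (Finset.mem_sdiff.1 hx').2 (hsub hx))

/-! ### Nebeský's condition and maximal tight partitions -/

namespace LooplessMultigraph

variable {V ε : Type*} {M : LooplessMultigraph V ε}

lemma ends_nonempty {e : ε} (he : e ∈ M.edges) : (M.ends e).Nonempty := by
  rw [← Finset.card_pos, M.card_ends e he]; norm_num

lemma exists_ne_mem_ends {e : ε} (he : e ∈ M.edges) (x : V) : ∃ y ∈ M.ends e, y ≠ x :=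
  Finset.exists_mem_ne (by rw [M.card_ends e he]; norm_num) x

variable (M) [DecidableEq V]

/-- The edges with both ends in `D`. -/
def inside (D : Finset V) : Finset ε := {e ∈ M.edges | M.ends e ⊆ D}

/-- The degree of `x` in the subgraph induced by `D`. -/
def degIn (D : Finset V) (x : V) : ℕ := #{e ∈ M.inside D | x ∈ M.ends e}

/-- The smallest integer that exceeds the number of edges inside `D` and has the parity of `#D`.
So it is `e(D) + 1`, plus one if `D` is nonempty and the cyclomatic number of a connected graph
on `D` with `e(D)` edges is odd. -/
def weight (D : Finset V) : ℕ := #(M.inside D) + 1 + if Even (#(M.inside D) + #D) then 1 else 0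

/-- Nebeský's condition for the subgraph induced by `W`. It says that for every partition of `W`,
the number of parts plus the number of parts with odd cyclomatic number is at most one more than the
number of edges between the parts. -/
def Balanced (W : Finset V) : Prop :=
  ∀ P : Finpartition W, ∑ D ∈ P.parts, M.weight D ≤ #(M.inside W) + 1

/-- The subgraph induced by `A` is connected: no set of vertices is separated from the rest. -/
def ConnectedOn (A : Finset V) : Prop :=
  A.Nonempty ∧ ∀ Y ⊆ A, Y.Nonempty →
    (∀ e ∈ M.inside A, ¬ Disjoint (M.ends e) Y → M.ends e ⊆ Y) → Y = A

/-- `J` is an independent set of vertices of degree three in the subgraph induced by `W`, whose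
removal from it leaves a tree. The tree is described as a connected graph with one vertex more than
it has edges, where its edges are those inside `W` except three for each vertex of `J`. -/
structure IsTreeComplement (W J : Finset V) : Prop where
  subset : J ⊆ W
  indep : ∀ e ∈ M.edges, ¬ M.ends e ⊆ J
  degIn_eq : ∀ x ∈ J, M.degIn W x = 3
  connected : M.ConnectedOn (W \ J)
  card_eq : #(M.inside W) + 1 = #W + 2 * #J

variable {M}

lemma mem_inside {D : Finset V} {e : ε} : e ∈ M.inside D ↔ e ∈ M.edges ∧ M.ends e ⊆ D :=
  Finset.mem_filter

lemma inside_mono {D D' : Finset V} (h : D ⊆ D') : M.inside D ⊆ M.inside D' := fun _ he =>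
  mem_inside.2 ⟨(mem_inside.1 he).1, (mem_inside.1 he).2.trans h⟩

lemma inside_singleton (x : V) : M.inside {x} = ∅ := by
  rw [Finset.eq_empty_iff_forall_notMem]
  intro e he
  obtain ⟨h1, h2⟩ := mem_inside.1 he
  obtain ⟨y, hy, hne⟩ := exists_ne_mem_ends h1 x
  exact hne (Finset.mem_singleton.1 (h2 hy))

lemma card_inside_erase (D : Finset V) (x : V) :
    #(M.inside (D.erase x)) + M.degIn D x = #(M.inside D) := by
  have h : M.inside (D.erase x) = {e ∈ M.inside D | ¬ x ∈ M.ends e} := by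
    ext e
    simp only [mem_inside, mem_filter, Finset.subset_erase]
    tauto
  rw [h, degIn, add_comm]
  exact Finset.card_filter_add_card_filter_not _

lemma degIn_mono {D D' : Finset V} (h : D ⊆ D') (x : V) : M.degIn D x ≤ M.degIn D' x :=
  Finset.card_le_card (Finset.filter_subset_filter _ (inside_mono h))

lemma degIn_le {D : Finset V} {x : V} : M.degIn D x ≤ #{e ∈ M.edges | x ∈ M.ends e} :=
  Finset.card_le_card (Finset.filter_subset_filter _ (Finset.filter_subset _ _))

lemma degIn_add_card_le {D : Finset V} {x : V} {F : Finset ε}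
    (hF : ∀ e ∈ F, e ∈ M.edges ∧ x ∈ M.ends e ∧ ¬ M.ends e ⊆ D) :
    M.degIn D x + #F ≤ #{e ∈ M.edges | x ∈ M.ends e} := by
  classical
  rw [degIn, ← Finset.card_union_of_disjoint]
  · refine Finset.card_le_card fun e he => ?_
    rcases Finset.mem_union.1 he with he | he
    · rw [mem_filter, mem_inside] at he
      exact Finset.mem_filter.2 ⟨he.1.1, he.2⟩
    · exact Finset.mem_filter.2 ⟨(hF e he).1, (hF e he).2.1⟩
  · rw [Finset.disjoint_left]
    intro e he he'
    rw [mem_filter, mem_inside] at he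
    exact (hF e he').2.2 he.1.2

lemma ends_subset_of_degIn_eq_three (hdeg : ∀ x, #{e ∈ M.edges | x ∈ M.ends e} ≤ 3)
    {D : Finset V} {x : V} (hx : M.degIn D x = 3) {e : ε} (he : e ∈ M.edges) (hxe : x ∈ M.ends e) :
    M.ends e ⊆ D := by
  by_contra h
  have h1 := degIn_add_card_le (M := M) (D := D) (x := x) (F := {e}) (by simp [he, hxe, h])
  rw [hx, Finset.card_singleton] at h1
  have := hdeg x
  omega

lemma weight_ge (D : Finset V) : #(M.inside D) + 1 ≤ M.weight D := Nat.le_add_right _ _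

lemma weight_le (D : Finset V) : M.weight D ≤ #(M.inside D) + 2 := by
  unfold weight; split <;> omega

lemma even_weight_add (D : Finset V) : Even (M.weight D + #D) := by
  unfold weight
  split
  · rename_i h
    have : #(M.inside D) + 1 + 1 + #D = (#(M.inside D) + #D) + 2 := by ring
    rw [this]
    exact h.add even_two
  · rename_i h
    have : #(M.inside D) + 1 + 0 + #D = (#(M.inside D) + #D) + 1 := by ring
    rw [this]
    exact (Nat.not_even_iff_odd.1 h).add_one

lemma weight_singleton (x : V) : M.weight {x} = 1 := by
  simp [weight, inside_singleton]

lemma even_sum_weight {W : Finset V} (P : Finpartition W) :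
    Even (∑ D ∈ P.parts, M.weight D + #W) := by
  rw [← P.sum_card_parts, ← Finset.sum_add_distrib]
  exact Finset.even_sum _ fun D _ => even_weight_add D

lemma sum_indiscrete {W : Finset V} (hW : W ≠ ⊥) (f : Finset V → ℕ) :
    ∑ D ∈ (Finpartition.indiscrete hW).parts, f D = f W := Finset.sum_singleton _ _

lemma Balanced.weight_eq {W : Finset V} (h : M.Balanced W) (hW : W.Nonempty) :
    M.weight W = #(M.inside W) + 1 := by
  have h1 := h (Finpartition.indiscrete (Finset.nonempty_iff_ne_empty.1 hW))
  rw [sum_indiscrete] at h1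
  have := weight_ge (M := M) W
  omega

lemma Balanced.connectedOn {W : Finset V} (h : M.Balanced W) (hW : W.Nonempty) :
    M.ConnectedOn W := by
  refine ⟨hW, fun Y hY hYne hclosed => ?_⟩
  by_contra hne
  have hcne : (W \ Y).Nonempty := by
    rw [Finset.sdiff_nonempty]
    exact fun h => hne (hY.antisymm h)
  obtain ⟨R, -, hR⟩ := (Finpartition.indiscrete (Finset.nonempty_iff_ne_empty.1 hYne)).exists_union
    (Finpartition.indiscrete (Finset.nonempty_iff_ne_empty.1 hcne)) Finset.disjoint_sdiff
    (Finset.union_sdiff_of_subset hY)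
  have h1 := h R
  rw [hR, sum_indiscrete, sum_indiscrete] at h1
  have h2 := weight_ge (M := M) Y
  have h3 := weight_ge (M := M) (W \ Y)
  classical
  have h4 : M.inside W ⊆ M.inside Y ∪ M.inside (W \ Y) := by
    intro e he
    have he' := mem_inside.1 he
    rw [mem_union, mem_inside, mem_inside, Finset.subset_sdiff]
    by_cases hd : Disjoint (M.ends e) Y
    · exact Or.inr ⟨he'.1, he'.2, hd⟩
    · exact Or.inl ⟨he'.1, hclosed e he hd⟩
  have h5 := (Finset.card_le_card h4).trans (Finset.card_union_le _ _)
  omega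

/-- The edges inside `W` that join different parts. -/
def cross (M : LooplessMultigraph V ε) {W : Finset V} (P : Finpartition W) : Finset ε :=
  {e ∈ M.inside W | ∀ D ∈ P.parts, ¬ M.ends e ⊆ D}

lemma sum_card_inside_add_card_filter_cross {W : Finset V} (P : Finpartition W)
    {X : Finset (Finset V)} (hX : X ⊆ P.parts) :
    ∑ D ∈ X, #(M.inside D) + #{e ∈ M.cross P | M.ends e ⊆ X.sup id} ≤ #(M.inside (X.sup id)) := by
  classical
  rw [← Finset.card_biUnion, ← Finset.card_union_of_disjoint]
  · refine Finset.card_le_card fun e he => ?_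
    rcases Finset.mem_union.1 he with he | he
    · obtain ⟨D, hD, he⟩ := Finset.mem_biUnion.1 he
      exact inside_mono (Finset.le_sup (f := id) hD) he
    · rw [mem_filter, cross, mem_filter, mem_inside] at he
      exact mem_inside.2 ⟨he.1.1.1, he.2⟩
  · rw [Finset.disjoint_left]
    intro e he he'
    obtain ⟨D, hD, he⟩ := Finset.mem_biUnion.1 he
    exact (Finset.mem_filter.1 (Finset.mem_filter.1 he').1).2 D (hX hD) (mem_inside.1 he).2
  · intro D hD D' hD' hne
    refine Finset.disjoint_left.2 fun e he he' => ?_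
    obtain ⟨v, hv⟩ := ends_nonempty (mem_inside.1 he).1
    exact Finset.disjoint_left.1 (P.disjoint (hX hD) (hX hD') hne)
      ((mem_inside.1 he).2 hv) ((mem_inside.1 he').2 hv)

lemma card_inside_eq {W : Finset V} (P : Finpartition W) :
    #(M.inside W) = ∑ D ∈ P.parts, #(M.inside D) + #(M.cross P) := by
  classical
  apply le_antisymm
  · have h : M.inside W ⊆ (P.parts.biUnion fun D => M.inside D) ∪ M.cross P := by
      intro e he
      by_cases hc : ∀ D ∈ P.parts, ¬ M.ends e ⊆ D
      · exact Finset.mem_union_right _ (Finset.mem_filter.2 ⟨he, hc⟩)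
      · push Not at hc
        obtain ⟨D, hD, hs⟩ := hc
        exact Finset.mem_union_left _
          (Finset.mem_biUnion.2 ⟨D, hD, mem_inside.2 ⟨(mem_inside.1 he).1, hs⟩⟩)
    exact (Finset.card_le_card h).trans ((Finset.card_union_le _ _).trans
      (Nat.add_le_add_right Finset.card_biUnion_le _))
  · have h := sum_card_inside_add_card_filter_cross (M := M) P subset_rfl
    rw [P.sup_parts, Finset.filter_true_of_mem] at h
    · exact h
    · intro e he
      exact (mem_inside.1 (Finset.mem_filter.1 he).1).2

/-- A partition that attains equality in Nebeský's condition with the largest number of parts. -/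
structure IsMaxTight {W : Finset V} (M : LooplessMultigraph V ε) (P : Finpartition W) : Prop where
  tight : ∑ D ∈ P.parts, M.weight D = #(M.inside W) + 1
  max : ∀ Q : Finpartition W, ∑ D ∈ Q.parts, M.weight D = #(M.inside W) + 1 →
    #Q.parts ≤ #P.parts

lemma Balanced.exists_isMaxTight {W : Finset V} (h : M.Balanced W) (hW : W.Nonempty) :
    ∃ P : Finpartition W, M.IsMaxTight P := by
  obtain ⟨P, hP, hmax⟩ := Set.exists_max_image
    {P : Finpartition W | ∑ D ∈ P.parts, M.weight D = #(M.inside W) + 1}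
    (fun P => #P.parts) (Set.toFinite _)
    ⟨Finpartition.indiscrete (Finset.nonempty_iff_ne_empty.1 hW), by
      show ∑ D ∈ _, _ = _
      rw [sum_indiscrete, h.weight_eq hW]⟩
  exact ⟨P, hP, fun Q hQ => hmax Q hQ⟩

/-- Refining a part of a maximal tight partition destroys tightness, and for reasons of parity
the sum of the weights drops by at least two. -/
lemma IsMaxTight.sum_weight_add_two_le {W : Finset V} {P : Finpartition W} (hP : M.IsMaxTight P)
    (hW : M.Balanced W) {D : Finset V} (hD : D ∈ P.parts) (Q : Finpartition D)
    (hQ : 2 ≤ #Q.parts) : ∑ X ∈ Q.parts, M.weight X + 2 ≤ M.weight D := by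
  obtain ⟨R, hRc, hRs⟩ := P.exists_refine hD Q
  have h1 := hW R
  have h2 : ∑ X ∈ R.parts, M.weight X ≠ #(M.inside W) + 1 := fun h => by
    have := hP.max R h
    omega
  have h3 := even_sum_weight (M := M) R
  have h4 := even_sum_weight (M := M) P
  have h5 := hRs M.weight
  have h6 := hP.tight
  rw [Nat.even_iff] at h3 h4
  omega

lemma IsMaxTight.sum_weight_erase_add_three_le {W : Finset V} {P : Finpartition W}
    (hP : M.IsMaxTight P) (hW : M.Balanced W) {D : Finset V} (hD : D ∈ P.parts) {x : V}
    (hx : x ∈ D) (hc : 2 ≤ #D) (Q : Finpartition (D.erase x)) :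
    ∑ X ∈ Q.parts, M.weight X + 3 ≤ M.weight D := by
  obtain ⟨R, hRc, hR⟩ := Q.exists_union
    (Finpartition.indiscrete (Finset.singleton_ne_empty x)) (C := D)
    (by simp) (by rw [Finset.union_comm, ← Finset.insert_eq, Finset.insert_erase hx])
  have hQ : 0 < #Q.parts := by
    rw [Finset.card_pos]
    apply Q.parts_nonempty
    rw [Finset.bot_eq_empty, ← Finset.nonempty_iff_ne_empty, ← Finset.card_pos,
      Finset.card_erase_of_mem hx]
    omega
  have h1 : #(Finpartition.indiscrete (Finset.singleton_ne_empty x)).parts = 1 :=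
    Finset.card_singleton _
  have h2 := hP.sum_weight_add_two_le hW hD R (by omega)
  rw [hR, sum_indiscrete, weight_singleton] at h2
  exact h2

lemma IsMaxTight.le_degIn {W : Finset V} {P : Finpartition W}
    (hP : M.IsMaxTight P) (hW : M.Balanced W) {D : Finset V} (hD : D ∈ P.parts) {x : V}
    (hx : x ∈ D) (hc : 2 ≤ #D) : #(M.inside D) + 4 ≤ M.weight D + M.degIn D x := by
  have hne : (D.erase x) ≠ ⊥ := by
    rw [Finset.bot_eq_empty, ← Finset.nonempty_iff_ne_empty, ← Finset.card_pos,
      Finset.card_erase_of_mem hx]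
    omega
  have h1 := hP.sum_weight_erase_add_three_le hW hD hx hc (Finpartition.indiscrete hne)
  rw [sum_indiscrete] at h1
  have h2 := weight_ge (M := M) (D.erase x)
  have h3 := card_inside_erase (M := M) D x
  omega

lemma IsMaxTight.balanced_erase {W : Finset V} {P : Finpartition W}
    (hP : M.IsMaxTight P) (hW : M.Balanced W) {D : Finset V} (hD : D ∈ P.parts) {x : V}
    (hx : x ∈ D) (hc : 2 ≤ #D) (h : M.weight D + M.degIn D x ≤ #(M.inside D) + 4) :
    M.Balanced (D.erase x) := by
  intro Q
  have h1 := hP.sum_weight_erase_add_three_le hW hD hx hc Q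
  have h3 := card_inside_erase (M := M) D x
  omega

/-- A set of parts of a maximal tight partition is spanned by few edges between the parts, as
merging these parts does not violate Nebeský's condition. -/
lemma IsMaxTight.card_filter_cross_lt {W : Finset V} {P : Finpartition W}
    (hP : M.IsMaxTight P) (hW : M.Balanced W) {X : Finset (Finset V)} (hX : X ⊆ P.parts)
    (hne : X.Nonempty) :
    #{e ∈ M.cross P | M.ends e ⊆ X.sup id} + ∑ D ∈ X, #(M.inside D) + 1 ≤
      ∑ D ∈ X, M.weight D := by
  obtain ⟨R, hR⟩ := P.exists_merge hX hne
  have h1 := hW R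
  have h2 := hR M.weight
  have h3 := hP.tight
  have h4 := weight_ge (M := M) (X.sup id)
  have h5 := sum_card_inside_add_card_filter_cross (M := M) P hX
  omega

lemma connectedOn_singleton (x : V) : M.ConnectedOn {x} := by
  refine ⟨Finset.singleton_nonempty x, fun Y hY hne _ => ?_⟩
  exact (Finset.subset_singleton_iff.1 hY).resolve_left hne.ne_empty

lemma IsTreeComplement.insert (hdeg : ∀ x, #{e ∈ M.edges | x ∈ M.ends e} ≤ 3)
    {W J : Finset V} {x : V} (hx : x ∈ W) (hd : M.degIn W x = 3)
    (hJ : M.IsTreeComplement (W.erase x) J) : M.IsTreeComplement W (insert x J) := by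
  have hxJ : x ∉ J := fun h => Finset.notMem_erase x W (hJ.subset h)
  have hJx : ∀ y ∈ J, ∀ e ∈ M.edges, y ∈ M.ends e → x ∉ M.ends e := fun y hy e he hye h =>
    Finset.notMem_erase x W (ends_subset_of_degIn_eq_three hdeg (hJ.degIn_eq y hy) he hye h)
  refine ⟨Finset.insert_subset hx (hJ.subset.trans (Finset.erase_subset _ _)), ?_, ?_, ?_, ?_⟩
  · intro e he hsub
    by_cases hxe : x ∈ M.ends e
    · obtain ⟨y, hy, hne⟩ := exists_ne_mem_ends he x
      exact hJx y ((Finset.mem_insert.1 (hsub hy)).resolve_left hne) e he hy hxe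
    · exact hJ.indep e he ((Finset.subset_insert_iff_of_notMem hxe).1 hsub)
  · intro y hy
    rcases Finset.mem_insert.1 hy with rfl | hy
    · exact hd
    · have h1 := degIn_mono (M := M) (Finset.erase_subset x W) y
      have h2 := degIn_le (M := M) (D := W) (x := y)
      have h3 := hdeg y
      have h4 := hJ.degIn_eq y hy
      omega
  · have : W \ Insert.insert x J = W.erase x \ J := by
      rw [Finset.erase_eq, sdiff_sdiff, Finset.sup_eq_union, Finset.insert_eq]
    rw [this]
    exact hJ.connected
  · have h1 := card_inside_erase (M := M) W x
    have h2 := hJ.card_eq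
    have h3 := Finset.card_erase_add_one hx
    rw [Finset.card_insert_of_notMem hxJ]
    omega

end LooplessMultigraph

/-! ### Sufficiency of Nebeský's condition for subcubic graphs -/

namespace LooplessMultigraph

variable {V ε : Type*} {M : LooplessMultigraph V ε} [DecidableEq V]

/-- The parts of a partition that contain an end of `e`. -/
def partsAt (M : LooplessMultigraph V ε) {W : Finset V} (P : Finpartition W) (e : ε) :
    Finset (Finset V) := {D ∈ P.parts | ¬ Disjoint (M.ends e) D}

lemma mem_partsAt {W : Finset V} {P : Finpartition W} {e : ε} {D : Finset V} :
    D ∈ M.partsAt P e ↔ D ∈ P.parts ∧ ∃ v ∈ M.ends e, v ∈ D := by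
  rw [partsAt, mem_filter, Finset.not_disjoint_iff]

lemma mem_cross {W : Finset V} {P : Finpartition W} {e : ε} :
    e ∈ M.cross P ↔ (e ∈ M.edges ∧ M.ends e ⊆ W) ∧ ∀ D ∈ P.parts, ¬ M.ends e ⊆ D := by
  rw [cross, mem_filter, mem_inside]

lemma ends_subset_sup {W : Finset V} {P : Finpartition W} {e : ε} (he : M.ends e ⊆ W)
    {X : Finset (Finset V)} (hX : M.partsAt P e ⊆ X) : M.ends e ⊆ X.sup id := by
  intro v hv
  obtain ⟨D, hD, hvD⟩ := P.exists_mem (he hv)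
  exact Finset.mem_sup.2 ⟨D, hX (mem_partsAt.2 ⟨hD, v, hv, hvD⟩), hvD⟩

/-- The parts of a maximal tight partition with more than one part: each has one vertex, or
its weight exceeds the number of its edges by two. Otherwise all its vertices have degree three
inside it, so no edge leaves it. -/
lemma IsMaxTight.weight_eq {W : Finset V} {P : Finpartition W} (hP : M.IsMaxTight P)
    (hW : M.Balanced W) (hdeg : ∀ x, #{e ∈ M.edges | x ∈ M.ends e} ≤ 3)
    (h2 : 2 ≤ #P.parts) {D : Finset V} (hD : D ∈ P.parts) :
    M.weight D = #(M.inside D) + 1 + if 2 ≤ #D then 1 else 0 := by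
  have hDne := P.nonempty_of_mem_parts hD
  split_ifs with hc
  · by_contra hw
    have h3 : ∀ x ∈ D, M.degIn D x = 3 := by
      intro x hx
      have h4 := hP.le_degIn hW hD hx hc
      have h5 := weight_le (M := M) D
      have h6 := (degIn_le (M := M) (D := D) (x := x)).trans (hdeg x)
      omega
    have hWne : W.Nonempty := hDne.mono (P.subset hD)
    have hDW : D = W := (hW.connectedOn hWne).2 D (P.subset hD) hDne fun e he hd => by
      obtain ⟨x, hxe, hx⟩ := Finset.not_disjoint_iff.1 hd
      exact ends_subset_of_degIn_eq_three hdeg (h3 x hx) (mem_inside.1 he).1 hxe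
    have h1 : P.parts ⊆ {D} := by
      intro D' hD'
      obtain ⟨v, hv⟩ := P.nonempty_of_mem_parts hD'
      rw [Finset.mem_singleton]
      exact P.eq_of_mem_parts hD' hD hv (hDW ▸ P.subset hD' hv)
    have := Finset.card_le_card h1
    rw [Finset.card_singleton] at this
    omega
  · have h1 : #D = 1 := by
      have := hDne.card_pos
      omega
    obtain ⟨x, rfl⟩ := Finset.card_eq_one.1 h1
    rw [weight_singleton, inside_singleton]
    simp

/-- In a maximal tight partition with more than one part, the edges between the parts connect
the parts even after each part with more than one vertex has been given a private edge that
leaves it. -/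
lemma IsMaxTight.exists_connecting {W : Finset V} {P : Finpartition W} (hP : M.IsMaxTight P)
    (hW : M.Balanced W) (hdeg : ∀ x, #{e ∈ M.edges | x ∈ M.ends e} ≤ 3) (h2 : 2 ≤ #P.parts) :
    ∃ (K : Finset ε) (s : Finset V → ε), K ⊆ M.cross P ∧
      (∀ D ∈ P.parts, 2 ≤ #D → s D ∈ M.cross P ∧ s D ∉ K ∧ ∃ x ∈ M.ends (s D), x ∈ D) ∧
      (∀ D ∈ P.parts, 2 ≤ #D → ∀ D' ∈ P.parts, 2 ≤ #D' → s D = s D' → D = D') ∧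
      ∀ Y ⊆ P.parts, Y.Nonempty →
        (∀ e ∈ K, ¬ Disjoint (M.partsAt P e) Y → M.partsAt P e ⊆ Y) → Y = P.parts := by
  classical
  set O : Finset (Finset V) := {D ∈ P.parts | 2 ≤ #D} with hO
  have hsum : ∀ X ⊆ P.parts, ∑ D ∈ X, M.weight D = ∑ D ∈ X, #(M.inside D) + #X + #(X ∩ O) := by
    intro X hX
    have h1 : X ∩ O = {D ∈ X | 2 ≤ #D} := by
      ext D
      simp only [hO, mem_inter, mem_filter]
      exact ⟨fun h => ⟨h.1, h.2.2⟩, fun h => ⟨h.1, hX h.1, h.2⟩⟩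
    rw [Finset.sum_congr rfl fun D hD => hP.weight_eq hW hdeg h2 (hX hD), Finset.sum_add_distrib,
      Finset.sum_add_distrib, ← Finset.card_filter, h1]
    simp
  have hOP : O ⊆ P.parts := Finset.filter_subset _ _
  have hcard : #(M.cross P) + 1 = #P.parts + #O := by
    have h3 := hsum P.parts subset_rfl
    have h4 := hP.tight
    have h5 := card_inside_eq (M := M) P
    rw [Finset.inter_eq_right.2 hOP] at h3
    omega
  have hne : Nonempty ε := by
    have : (M.cross P).Nonempty := by
      rw [← Finset.card_pos]; omega
    exact ⟨this.choose⟩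
  obtain ⟨r, hr⟩ : P.parts.Nonempty := by
    rw [← Finset.card_pos]; omega
  obtain ⟨K, s, hK, hs, hinj, hY⟩ := exists_connecting_with_spare P.parts O (M.cross P)
    (M.partsAt P) r hr hOP (fun e _ => Finset.filter_subset _ _) (fun e he => by
      obtain ⟨⟨he1, he2⟩, -⟩ := mem_cross.1 he
      obtain ⟨v, hv⟩ := ends_nonempty he1
      obtain ⟨D, hD, hvD⟩ := P.exists_mem (he2 hv)
      exact ⟨D, mem_partsAt.2 ⟨hD, v, hv, hvD⟩⟩) hcard (fun X hX hXne => by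
      have h3 := hP.card_filter_cross_lt hW hX hXne
      have h4 := hsum X hX
      have h5 : #{e ∈ M.cross P | M.partsAt P e ⊆ X} ≤
          #{e ∈ M.cross P | M.ends e ⊆ X.sup id} := by
        refine Finset.card_le_card fun e he => ?_
        rw [mem_filter] at he ⊢
        exact ⟨he.1, ends_subset_sup (mem_cross.1 he.1).1.2 he.2⟩
      omega)
  refine ⟨K, s, hK, fun D hD hc => ?_, fun D hD hc D' hD' hc' h => ?_, hY⟩
  · obtain ⟨h3, h4, h5⟩ := hs D (Finset.mem_filter.2 ⟨hD, hc⟩)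
    exact ⟨h3, h4, (mem_partsAt.1 h5).2⟩
  · exact hinj (Finset.mem_coe.2 (Finset.mem_filter.2 ⟨hD, hc⟩))
      (Finset.mem_coe.2 (Finset.mem_filter.2 ⟨hD', hc'⟩)) h

/-- Solutions inside the parts of a maximal tight partition combine to one for the whole graph:
each part with more than one vertex contributes the end of its private edge, together with a
solution for the part without this vertex. -/
lemma IsMaxTight.exists_isTreeComplement {W : Finset V} {P : Finpartition W} (hP : M.IsMaxTight P)
    (hW : M.Balanced W) (hdeg : ∀ x, #{e ∈ M.edges | x ∈ M.ends e} ≤ 3) (h2 : 2 ≤ #P.parts)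
    (ih : ∀ D ∈ P.parts, 2 ≤ #D → ∀ x ∈ D, M.Balanced (D.erase x) →
      ∃ J, M.IsTreeComplement (D.erase x) J) :
    ∃ J, M.IsTreeComplement W J := by
  classical
  obtain ⟨K, s, hK, hs, hinj, hY⟩ := hP.exists_connecting hW hdeg h2
  set O : Finset (Finset V) := {D ∈ P.parts | 2 ≤ #D} with hO
  have hOP : ∀ D ∈ O, D ∈ P.parts := fun D hD => (Finset.mem_filter.1 hD).1
  have hs' : ∀ D ∈ O, s D ∈ M.cross P ∧ s D ∉ K ∧ ∃ x ∈ M.ends (s D), x ∈ D := fun D hD =>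
    hs D (hOP D hD) (Finset.mem_filter.1 hD).2
  have hinj' : ∀ D ∈ O, ∀ D' ∈ O, s D = s D' → D = D' := fun D hD D' hD' h =>
    hinj D (hOP D hD) (Finset.mem_filter.1 hD).2 D' (hOP D' hD') (Finset.mem_filter.1 hD').2 h
  have hchoose : ∀ D : Finset V, ∃ (x : V) (J : Finset V), D ∈ O →
      x ∈ M.ends (s D) ∧ x ∈ D ∧ M.degIn D x = 2 ∧ M.IsTreeComplement (D.erase x) J := by
    intro D
    by_cases hD : D ∈ O
    · obtain ⟨hc, -, x, hxe, hx⟩ := hs' D hD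
      obtain ⟨hDP, hD2⟩ := Finset.mem_filter.1 hD
      have hw := hP.weight_eq hW hdeg h2 hDP
      rw [if_pos hD2] at hw
      have hd1 := hP.le_degIn hW hDP hx hD2
      have hd2 : M.degIn D x ≠ 3 := fun h =>
        (mem_cross.1 hc).2 D hDP
          (ends_subset_of_degIn_eq_three hdeg h (mem_cross.1 hc).1.1 hxe)
      have hd3 := (degIn_le (M := M) (D := D) (x := x)).trans (hdeg x)
      obtain ⟨J, hJ⟩ := ih D hDP hD2 x hx (hP.balanced_erase hW hDP hx hD2 (by omega))
      exact ⟨x, J, fun _ => ⟨hxe, hx, by omega, hJ⟩⟩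
    · obtain ⟨v, -⟩ : W.Nonempty := by
        obtain ⟨D, hD⟩ : P.parts.Nonempty := by
          rw [← Finset.card_pos]; omega
        exact (P.nonempty_of_mem_parts hD).mono (P.subset hD)
      exact ⟨v, ∅, fun h => absurd h hD⟩
  choose x JD hx using hchoose
  have hxs : ∀ D ∈ O, x D ∈ M.ends (s D) := fun D hD => (hx D hD).1
  have hxD : ∀ D ∈ O, x D ∈ D := fun D hD => (hx D hD).2.1
  have hx2 : ∀ D ∈ O, M.degIn D (x D) = 2 := fun D hD => (hx D hD).2.2.1
  have hJD : ∀ D ∈ O, M.IsTreeComplement (D.erase (x D)) (JD D) := fun D hD => (hx D hD).2.2.2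
  -- An edge at a vertex of `JD D` stays inside `D` and avoids `x D`.
  have hF1 : ∀ D ∈ O, ∀ y ∈ JD D, ∀ e ∈ M.edges, y ∈ M.ends e → M.ends e ⊆ D.erase (x D) :=
    fun D hD y hy e he hye =>
      ends_subset_of_degIn_eq_three hdeg ((hJD D hD).degIn_eq y hy) he hye
  -- The only edge at `x D` that leaves `D` is the private edge of `D`.
  have hF2 : ∀ D ∈ O, ∀ e ∈ M.edges, x D ∈ M.ends e → M.ends e ⊆ D ∨ e = s D := by
    intro D hD e he hxe
    by_contra! hcon
    have hsc := mem_cross.1 (hs' D hD).1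
    have h1 := degIn_add_card_le (M := M) (D := D) (x := x D) (F := {e, s D}) (by
      intro e' he'
      rcases Finset.mem_insert.1 he' with rfl | he'
      · exact ⟨he, hxe, hcon.1⟩
      · rw [Finset.mem_singleton] at he'
        subst he'
        exact ⟨hsc.1.1, hxs D hD, hsc.2 D (hOP D hD)⟩)
    rw [Finset.card_pair hcon.2, hx2 D hD] at h1
    have := hdeg (x D)
    omega
  have hJsub : ∀ D ∈ O, insert (x D) (JD D) ⊆ D := fun D hD =>
    Finset.insert_subset (hxD D hD) ((hJD D hD).subset.trans (Finset.erase_subset _ _))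
  have hxJ : ∀ D ∈ O, x D ∉ JD D := fun D hD h =>
    Finset.notMem_erase (x D) D ((hJD D hD).subset h)
  set J : Finset V := O.biUnion fun D => insert (x D) (JD D) with hJ
  have hmemJ : ∀ v, v ∈ J → ∃ D ∈ O, v = x D ∨ v ∈ JD D := by
    intro v hv
    obtain ⟨D, hD, hv⟩ := Finset.mem_biUnion.1 hv
    exact ⟨D, hD, Finset.mem_insert.1 hv⟩
  have hJD' : ∀ D ∈ P.parts, ∀ v ∈ D, v ∈ J → D ∈ O ∧ (v = x D ∨ v ∈ JD D) := by
    intro D hD v hv hvJ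
    obtain ⟨D', hD', h⟩ := hmemJ v hvJ
    have : D = D' := P.eq_of_mem_parts hD (hOP D' hD') hv
      (hJsub D' hD' (Finset.mem_insert.2 h))
    subst this
    exact ⟨hD', h⟩
  have hcrossJ : ∀ e ∈ M.cross P, ∀ v ∈ M.ends e, v ∈ J → ∃ D ∈ O, v = x D ∧ e = s D := by
    intro e he v hve hvJ
    obtain ⟨⟨he1, -⟩, hec⟩ := mem_cross.1 he
    obtain ⟨D, hD, rfl | hv⟩ := hmemJ v hvJ
    · exact ⟨D, hD, rfl, (hF2 D hD e he1 hve).resolve_left (hec D (hOP D hD))⟩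
    · exact absurd ((hF1 D hD v hv e he1 hve).trans (Finset.erase_subset _ _)) (hec D (hOP D hD))
  have hsdiffO : ∀ D ∈ O, D \ J = D.erase (x D) \ JD D := by
    intro D hD
    ext v
    simp only [mem_sdiff, mem_erase]
    constructor
    · rintro ⟨hv, hvJ⟩
      have h : v ∉ insert (x D) (JD D) := fun h => hvJ (Finset.mem_biUnion.2 ⟨D, hD, h⟩)
      rw [mem_insert, not_or] at h
      exact ⟨⟨h.1, hv⟩, h.2⟩
    · rintro ⟨⟨h1, hv⟩, h2⟩
      refine ⟨hv, fun hvJ => ?_⟩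
      rcases (hJD' D (hOP D hD) v hv hvJ).2 with h | h
      · exact h1 h
      · exact h2 h
  have hconn : ∀ D ∈ P.parts, M.ConnectedOn (D \ J) := by
    intro D hD
    by_cases hDO : D ∈ O
    · rw [hsdiffO D hDO]
      exact (hJD D hDO).connected
    · have h1 : D \ J = D := by
        rw [Finset.sdiff_eq_self_iff_disjoint, Finset.disjoint_left]
        exact fun v hv hvJ => hDO (hJD' D hD v hv hvJ).1
      have h3 : #D = 1 := by
        have h4 : ¬ 2 ≤ #D := fun h => hDO (Finset.mem_filter.2 ⟨hD, h⟩)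
        have := (P.nonempty_of_mem_parts hD).card_pos
        omega
      obtain ⟨v, rfl⟩ := Finset.card_eq_one.1 h3
      rw [h1]
      exact connectedOn_singleton v
  refine ⟨J, ?_, ?_, ?_, ⟨?_, ?_⟩, ?_⟩
  · exact Finset.biUnion_subset.2 fun D hD => (hJsub D hD).trans (P.subset (hOP D hD))
  · intro e he hsub
    obtain ⟨v, hv⟩ := ends_nonempty he
    obtain ⟨D, hD, hvD | hvD⟩ := hmemJ v (hsub hv)
    · obtain ⟨w, hw, hne⟩ := exists_ne_mem_ends he v
      rcases hF2 D hD e he (hvD ▸ hv) with h | h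
      · rcases (hJD' D (hOP D hD) w (h hw) (hsub hw)).2 with hwx | hwJ
        · exact hne (hwx.trans hvD.symm)
        · exact Finset.notMem_erase (x D) D (hF1 D hD w hwJ e he hw (hvD ▸ hv))
      · obtain ⟨D', hD', hwx, h'⟩ := hcrossJ e (h ▸ (hs' D hD).1) w hw (hsub hw)
        have := hinj' D hD D' hD' (h.symm.trans h')
        subst this
        exact hne (hwx.trans hvD.symm)
    · have h1 := hF1 D hD v hvD e he hv
      refine (hJD D hD).indep e he fun w hw => ?_
      have h3 := Finset.mem_erase.1 (h1 hw)
      exact (hJD' D (hOP D hD) w h3.2 (hsub hw)).2.resolve_left h3.1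
  · intro v hv
    have h1 := (degIn_le (M := M) (D := W) (x := v)).trans (hdeg v)
    obtain ⟨D, hD, rfl | hvD⟩ := hmemJ v hv
    · have hsc := mem_cross.1 (hs' D hD).1
      have h3 : M.degIn D (x D) + 1 ≤ M.degIn W (x D) := by
        have hnot : s D ∉ {e ∈ M.inside D | x D ∈ M.ends e} := fun h =>
          hsc.2 D (hOP D hD) (mem_inside.1 (Finset.mem_filter.1 h).1).2
        rw [degIn, degIn, ← Finset.card_insert_of_notMem hnot]
        refine Finset.card_le_card (Finset.insert_subset ?_ ?_)
        · exact Finset.mem_filter.2 ⟨mem_inside.2 hsc.1, hxs D hD⟩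
        · exact Finset.filter_subset_filter _ (inside_mono (P.subset (hOP D hD)))
      have := hx2 D hD
      omega
    · have h3 := degIn_mono (M := M) ((Finset.erase_subset (x D) D).trans (P.subset (hOP D hD))) v
      have h4 := (hJD D hD).degIn_eq v hvD
      omega
  · obtain ⟨D, hD⟩ : P.parts.Nonempty := by
      rw [← Finset.card_pos]; omega
    exact (hconn D hD).1.mono (Finset.sdiff_subset_sdiff (P.subset hD) subset_rfl)
  · intro Y hYA hYne hclosed
    have hall : ∀ D ∈ P.parts, ¬ Disjoint D Y → D \ J ⊆ Y := by
      intro D hD hd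
      have h1 : Y ∩ (D \ J) = D \ J := by
        refine (hconn D hD).2 _ Finset.inter_subset_right ?_ fun e he hed => ?_
        · obtain ⟨v, hvD, hvY⟩ := Finset.not_disjoint_iff.1 hd
          exact ⟨v, Finset.mem_inter.2 ⟨hvY, Finset.mem_sdiff.2
            ⟨hvD, (Finset.mem_sdiff.1 (hYA hvY)).2⟩⟩⟩
        · refine Finset.subset_inter (hclosed e ?_ ?_) (mem_inside.1 he).2
          · exact inside_mono (Finset.sdiff_subset_sdiff (P.subset hD) subset_rfl) he
          · exact fun h => hed (h.mono_right Finset.inter_subset_left)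
      rw [← h1]
      exact Finset.inter_subset_left
    have hKA : ∀ e ∈ K, e ∈ M.inside (W \ J) := by
      intro e he
      obtain ⟨⟨he1, he2⟩, -⟩ := mem_cross.1 (hK he)
      refine mem_inside.2 ⟨he1, Finset.subset_sdiff.2 ⟨he2, Finset.disjoint_left.2 ?_⟩⟩
      intro v hv hvJ
      obtain ⟨D, hD, -, h⟩ := hcrossJ e (hK he) v hv hvJ
      exact (hs' D hD).2.1 (h ▸ he)
    have hparts : {D ∈ P.parts | ¬ Disjoint D Y} = P.parts := by
      refine hY _ (Finset.filter_subset _ _) ?_ ?_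
      · obtain ⟨v, hv⟩ := hYne
        obtain ⟨D, hD, hvD⟩ := P.exists_mem (Finset.mem_sdiff.1 (hYA hv)).1
        exact ⟨D, Finset.mem_filter.2 ⟨hD, Finset.not_disjoint_iff.2 ⟨v, hvD, hv⟩⟩⟩
      · intro e he hed
        obtain ⟨D, hDe, hDY⟩ := Finset.not_disjoint_iff.1 hed
        obtain ⟨hD, v, hve, hvD⟩ := mem_partsAt.1 hDe
        have heA := hKA e he
        have hvA := Finset.mem_sdiff.1 ((mem_inside.1 heA).2 hve)
        have hvY : v ∈ Y := hall D hD (Finset.mem_filter.1 hDY).2 (Finset.mem_sdiff.2 ⟨hvD, hvA.2⟩)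
        have hsub := hclosed e heA (Finset.not_disjoint_iff.2 ⟨v, hve, hvY⟩)
        intro D' hD'
        obtain ⟨hDP', w, hwe, hwD⟩ := mem_partsAt.1 hD'
        exact Finset.mem_filter.2 ⟨hDP', Finset.not_disjoint_iff.2 ⟨w, hwD, hsub hwe⟩⟩
    refine hYA.antisymm fun v hv => ?_
    obtain ⟨hvW, hvJ⟩ := Finset.mem_sdiff.1 hv
    obtain ⟨D, hD, hvD⟩ := P.exists_mem hvW
    rw [← hparts] at hD
    obtain ⟨hD, hd⟩ := Finset.mem_filter.1 hD
    exact hall D hD hd (Finset.mem_sdiff.2 ⟨hvD, hvJ⟩)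
  · -- Each part `D` has weight `#D + 2 * #(J ∩ D)`.
    have h1 : ∀ D ∈ P.parts,
        M.weight D = #D + if D ∈ O then 2 * #(insert (x D) (JD D)) else 0 := by
      intro D hD
      have hw := hP.weight_eq hW hdeg h2 hD
      by_cases hDO : D ∈ O
      · rw [if_pos (Finset.mem_filter.1 hDO).2] at hw
        have h3 := (hJD D hDO).card_eq
        have h4 := card_inside_erase (M := M) D (x D)
        have h5 := hx2 D hDO
        have h6 := Finset.card_erase_add_one (hxD D hDO)
        rw [if_pos hDO, Finset.card_insert_of_notMem (hxJ D hDO)]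
        omega
      · have h4 : ¬ 2 ≤ #D := fun h => hDO (Finset.mem_filter.2 ⟨hD, h⟩)
        have := (P.nonempty_of_mem_parts hD).card_pos
        obtain ⟨v, rfl⟩ := Finset.card_eq_one.1 (show #D = 1 by omega)
        rw [if_neg hDO, weight_singleton]
        simp
    have h3 : #J = ∑ D ∈ O, #(insert (x D) (JD D)) := by
      apply Finset.card_biUnion
      intro D hD D' hD' hne
      exact (P.disjoint (hOP D hD) (hOP D' hD') hne).mono (hJsub D hD) (hJsub D' hD')
    have h4 := hP.tight
    rw [Finset.sum_congr rfl h1, Finset.sum_add_distrib, P.sum_card_parts, ← Finset.sum_filter,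
      Finset.filter_mem_eq_inter, Finset.inter_eq_right.2 hOP, ← Finset.mul_sum, ← h3] at h4
    omega

/-- A subcubic loopless multigraph that satisfies Nebeský's condition has an independent set of
vertices of degree three whose removal leaves a tree. -/
theorem Balanced.exists_isTreeComplement (hdeg : ∀ x, #{e ∈ M.edges | x ∈ M.ends e} ≤ 3)
    {W : Finset V} (hW : M.Balanced W) (hne : W.Nonempty) : ∃ J, M.IsTreeComplement W J := by
  induction hn : #W using Nat.strong_induction_on generalizing W with
  | _ n ih =>
    subst hn
    obtain ⟨P, hP⟩ := hW.exists_isMaxTight hne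
    have herase : ∀ D ⊆ W, 2 ≤ #D → ∀ x ∈ D, M.Balanced (D.erase x) →
        ∃ J, M.IsTreeComplement (D.erase x) J := by
      intro D hD hc x hx hb
      have h1 := Finset.card_erase_add_one hx
      have h3 := Finset.card_le_card hD
      exact ih _ (by omega) hb (by rw [← Finset.card_pos]; omega) rfl
    by_cases h2 : 2 ≤ #P.parts
    · exact hP.exists_isTreeComplement hW hdeg h2 fun D hD => herase D (P.subset hD)
    have hWP : W ∈ P.parts := by
      have h3 : #P.parts = 1 := by
        have := (P.parts_nonempty (Finset.nonempty_iff_ne_empty.1 hne)).card_pos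
        omega
      obtain ⟨D, hD⟩ := Finset.card_eq_one.1 h3
      have h4 := P.sup_parts
      rw [hD, Finset.sup_singleton, id] at h4
      rw [hD, h4]
      exact Finset.mem_singleton_self W
    by_cases hc : 2 ≤ #W
    · obtain ⟨x, hx⟩ := hne
      have h3 := hW.weight_eq ⟨x, hx⟩
      have h4 := hP.le_degIn hW hWP hx hc
      have h5 := (degIn_le (M := M) (D := W) (x := x)).trans (hdeg x)
      obtain ⟨J, hJ⟩ := herase W subset_rfl hc x hx
        (hP.balanced_erase hW hWP hx hc (by omega))
      exact ⟨insert x J, hJ.insert hdeg hx (by omega)⟩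
    · have := hne.card_pos
      obtain ⟨v, rfl⟩ := Finset.card_eq_one.1 (show #W = 1 by omega)
      refine ⟨∅, Finset.empty_subset _, fun e he h => ?_, by simp, ?_, ?_⟩
      · exact (ends_nonempty he).ne_empty (Finset.subset_empty.1 h)
      · rw [Finset.sdiff_empty]
        exact connectedOn_singleton v
      · simp [inside_singleton]

end LooplessMultigraph

/-! ### Counting edges -/

namespace LooplessMultigraph

variable {V ε : Type*} {M : LooplessMultigraph V ε} [DecidableEq V]

lemma ends_eq_pair {e : ε} (he : e ∈ M.edges) {x y : V} (hx : x ∈ M.ends e) (hy : y ∈ M.ends e)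
    (hne : x ≠ y) : M.ends e = {x, y} := by
  symm
  apply Finset.eq_of_subset_of_card_le
  · exact Finset.insert_subset hx (Finset.singleton_subset_iff.2 hy)
  · rw [M.card_ends e he, Finset.card_pair hne]

/-- The edges with exactly one end in `D`. -/
def boundary (M : LooplessMultigraph V ε) (D : Finset V) : Finset ε :=
  {e ∈ M.edges | ¬ Disjoint (M.ends e) D ∧ ¬ M.ends e ⊆ D}

lemma boundary_sdiff {T : Finset V} (hT : ∀ e ∈ M.edges, M.ends e ⊆ T) (D : Finset V) :
    M.boundary (T \ D) = M.boundary D := by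
  ext e
  simp only [boundary, mem_filter, Finset.subset_sdiff, and_congr_right_iff]
  intro he
  have hs := hT e he
  have : Disjoint (M.ends e) (T \ D) ↔ M.ends e ⊆ D := by
    constructor
    · intro h x hx
      by_contra hxD
      exact Finset.disjoint_left.1 h hx (Finset.mem_sdiff.2 ⟨hs hx, hxD⟩)
    · intro h
      exact Finset.disjoint_left.2 fun x hx hx' => (Finset.mem_sdiff.1 hx').2 (h hx)
  rw [this]
  tauto

lemma sum_card_filter_mem_ends (D : Finset V) (F : Finset ε) :
    ∑ x ∈ D, #{e ∈ F | x ∈ M.ends e} = ∑ e ∈ F, #(M.ends e ∩ D) := by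
  have h := Finset.sum_card_bipartiteAbove_eq_sum_card_bipartiteBelow
    (s := D) (t := F) (fun x e => x ∈ M.ends e)
  simp only [Finset.bipartiteAbove, Finset.bipartiteBelow] at h
  rw [h]
  refine Finset.sum_congr rfl fun e _ => ?_
  rw [Finset.inter_comm, ← Finset.filter_mem_eq_inter]

lemma sum_card_filter_mem_ends_of_subset {D : Finset V} {F : Finset ε} (hF : F ⊆ M.inside D) :
    ∑ x ∈ D, #{e ∈ F | x ∈ M.ends e} = 2 * #F := by
  rw [sum_card_filter_mem_ends, Finset.sum_congr rfl fun e he => by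
    rw [Finset.inter_eq_left.2 (mem_inside.1 (hF he)).2, M.card_ends e (mem_inside.1 (hF he)).1],
    Finset.sum_const, smul_eq_mul, mul_comm]

lemma sum_degree_eq (D : Finset V) :
    ∑ x ∈ D, #{e ∈ M.edges | x ∈ M.ends e} = 2 * #(M.inside D) + #(M.boundary D) := by
  rw [sum_card_filter_mem_ends, ← Finset.sum_filter_add_sum_filter_not M.edges
    (fun e => M.ends e ⊆ D)]
  congr 1
  · rw [Finset.sum_congr rfl fun e he => by
      rw [Finset.inter_eq_left.2 (Finset.mem_filter.1 he).2,
        M.card_ends e (Finset.mem_filter.1 he).1], Finset.sum_const, smul_eq_mul, mul_comm]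
    rfl
  · have h : M.boundary D = {e ∈ {e ∈ M.edges | ¬ M.ends e ⊆ D} | ¬ Disjoint (M.ends e) D} := by
      ext e
      simp only [boundary, mem_filter]
      tauto
    rw [h, Finset.card_filter]
    refine Finset.sum_congr rfl fun e he => ?_
    obtain ⟨he1, he2⟩ := Finset.mem_filter.1 he
    by_cases hd : Disjoint (M.ends e) D
    · rw [if_neg (not_not.2 hd), Finset.disjoint_iff_inter_eq_empty.1 hd, Finset.card_empty]
    · have h1 : #(M.ends e ∩ D) < #(M.ends e) := by
        refine Finset.card_lt_card ⟨Finset.inter_subset_left, fun hs => he2 ?_⟩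
        exact hs.trans Finset.inter_subset_right
      have h2 : 0 < #(M.ends e ∩ D) := by
        rw [Finset.card_pos, ← Finset.not_disjoint_iff_nonempty_inter]
        exact hd
      rw [M.card_ends e he1] at h1
      rw [if_pos hd]
      omega

/-- A connected graph on `A` arises from any nonempty subgraph by adding vertices one by one, each
with at least one new edge. -/
lemma ConnectedOn.card_add_card_inside_le {A U : Finset V} (hA : M.ConnectedOn A) (hU : U ⊆ A)
    (hne : U.Nonempty) : #A + #(M.inside U) ≤ #(M.inside A) + #U := by
  classical
  induction hn : #(A \ U) generalizing U with
  | zero =>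
    rw [Finset.card_eq_zero, Finset.sdiff_eq_empty_iff_subset] at hn
    rw [hU.antisymm hn, add_comm]
  | succ n ih =>
    have hUA : U ≠ A := by
      rintro rfl
      simp at hn
    obtain ⟨e, he, hd, hs⟩ : ∃ e ∈ M.inside A, ¬ Disjoint (M.ends e) U ∧ ¬ M.ends e ⊆ U := by
      by_contra! hcon
      exact hUA (hA.2 U hU hne hcon)
    obtain ⟨w, hw, hwU⟩ := Finset.not_subset.1 hs
    obtain ⟨v, hv, hvU⟩ := Finset.not_disjoint_iff.1 hd
    obtain ⟨heE, heA⟩ := mem_inside.1 he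
    have hends := ends_eq_pair heE hw hv (fun h => hwU (h ▸ hvU))
    have hsub : insert e (M.inside U) ⊆ M.inside (insert w U) := by
      refine Finset.insert_subset (mem_inside.2 ⟨heE, ?_⟩)
        (inside_mono (Finset.subset_insert _ _))
      rw [hends]
      exact Finset.insert_subset_insert _ (Finset.singleton_subset_iff.2 hvU)
    have h1 := Finset.card_le_card hsub
    rw [Finset.card_insert_of_notMem (fun h => hs (mem_inside.1 h).2)] at h1
    have h2 := ih (Finset.insert_subset (heA hw) hU) (Finset.insert_nonempty _ _) (by
      rw [Finset.sdiff_insert, Finset.card_erase_of_mem (Finset.mem_sdiff.2 ⟨heA hw, hwU⟩), hn]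
      rfl)
    rw [Finset.card_insert_of_notMem hwU] at h2
    omega

/-- A nonempty graph with at least as many edges as vertices contains a connected two-regular
subgraph. A smallest subgraph of this kind is as required. -/
lemma exists_two_regular {D : Finset V} {F : Finset ε} (hF : F ⊆ M.inside D) (hD : D.Nonempty)
    (hc : #D ≤ #F) : ∃ D' ⊆ D, ∃ F' ⊆ F, D'.Nonempty ∧ F' ⊆ M.inside D' ∧
      (∀ x ∈ D', #{e ∈ F' | x ∈ M.ends e} = 2) ∧
      ∀ Y ⊆ D', Y.Nonempty → (∀ e ∈ F', ¬ Disjoint (M.ends e) Y → M.ends e ⊆ Y) → Y = D' := by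
  classical
  induction hn : #D + #F using Nat.strong_induction_on generalizing D F with
  | _ n ih =>
    subst hn
    have hsmall : ∀ D₁ ⊆ D, ∀ F₁ ⊆ F, D₁.Nonempty → F₁ ⊆ M.inside D₁ → #D₁ ≤ #F₁ →
        #D₁ + #F₁ < #D + #F → ∃ D' ⊆ D, ∃ F' ⊆ F, D'.Nonempty ∧ F' ⊆ M.inside D' ∧
          (∀ x ∈ D', #{e ∈ F' | x ∈ M.ends e} = 2) ∧
          ∀ Y ⊆ D', Y.Nonempty →
            (∀ e ∈ F', ¬ Disjoint (M.ends e) Y → M.ends e ⊆ Y) → Y = D' := by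
      intro D₁ hD₁ F₁ hF₁ hne hin hc₁ hlt
      obtain ⟨D', hD', F', hF', h⟩ := ih _ hlt hin hne hc₁ rfl
      exact ⟨D', hD'.trans hD₁, F', hF'.trans hF₁, h⟩
    by_cases hlt : #D < #F
    · obtain ⟨e, he⟩ : F.Nonempty := by
        rw [← Finset.card_pos]; omega
      have h1 := Finset.card_erase_add_one he
      exact hsmall D subset_rfl _ (Finset.erase_subset e F) hD ((Finset.erase_subset e F).trans hF)
        (by omega) (by omega)
    have hcard : #F = #D := by omega
    by_cases hdeg : ∃ x ∈ D, #{e ∈ F | x ∈ M.ends e} ≤ 1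
    · obtain ⟨x, hx, hx1⟩ := hdeg
      have h1 := Finset.card_erase_add_one hx
      have h2 : #{e ∈ F | x ∈ M.ends e} + #{e ∈ F | ¬ x ∈ M.ends e} = #F :=
        Finset.card_filter_add_card_filter_not _
      have hsub : {e ∈ F | ¬ x ∈ M.ends e} ⊆ M.inside (D.erase x) := by
        intro e he
        obtain ⟨heF, hxe⟩ := Finset.mem_filter.1 he
        have h := mem_inside.1 (hF heF)
        exact mem_inside.2 ⟨h.1, Finset.subset_erase.2 ⟨h.2, hxe⟩⟩
      refine hsmall _ (Finset.erase_subset x D) _ (Finset.filter_subset _ _) ?_ hsub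
        (by omega) (by omega)
      rw [Finset.nonempty_iff_ne_empty]
      intro h0
      have hDx : D = {x} := by
        rw [← Finset.insert_erase hx, h0, insert_empty_eq]
      rw [hDx, inside_singleton] at hF
      rw [Finset.subset_empty.1 hF, hDx] at hcard
      simp at hcard
    push Not at hdeg
    by_cases hconn : ∀ Y ⊆ D, Y.Nonempty →
        (∀ e ∈ F, ¬ Disjoint (M.ends e) Y → M.ends e ⊆ Y) → Y = D
    · refine ⟨D, subset_rfl, F, subset_rfl, hD, hF, fun x hx => ?_, hconn⟩
      by_contra hne
      have h1 : ∑ x ∈ D, 2 < ∑ x ∈ D, #{e ∈ F | x ∈ M.ends e} :=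
        Finset.sum_lt_sum (fun y hy => hdeg y hy) ⟨x, hx, lt_of_le_of_ne (hdeg x hx) (Ne.symm hne)⟩
      rw [sum_card_filter_mem_ends_of_subset hF, Finset.sum_const, smul_eq_mul] at h1
      omega
    push Not at hconn
    obtain ⟨Y, hYD, hYne, hclosed, hY⟩ := hconn
    have hcne : (D \ Y).Nonempty := by
      rw [Finset.sdiff_nonempty]
      exact fun h => hY (hYD.antisymm h)
    have h1 : #{e ∈ F | M.ends e ⊆ Y} + #{e ∈ F | ¬ M.ends e ⊆ Y} = #F :=
      Finset.card_filter_add_card_filter_not _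
    have h2 := Finset.card_sdiff_add_card_eq_card hYD
    have h3 := hYne.card_pos
    have h4 := hcne.card_pos
    have h5 := Finset.card_filter_le F (fun e => M.ends e ⊆ Y)
    have h6 := Finset.card_filter_le F (fun e => ¬ M.ends e ⊆ Y)
    by_cases h7 : #Y ≤ #{e ∈ F | M.ends e ⊆ Y}
    · refine hsmall Y hYD _ (Finset.filter_subset _ _) hYne (fun e he => ?_) h7 (by omega)
      obtain ⟨heF, heY⟩ := Finset.mem_filter.1 he
      exact mem_inside.2 ⟨(mem_inside.1 (hF heF)).1, heY⟩
    · refine hsmall (D \ Y) Finset.sdiff_subset {e ∈ F | ¬ M.ends e ⊆ Y}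
        (Finset.filter_subset _ _) hcne (fun e he => ?_)
        (by omega) (by omega)
      obtain ⟨heF, heY⟩ := Finset.mem_filter.1 he
      have h := mem_inside.1 (hF heF)
      refine mem_inside.2 ⟨h.1, Finset.subset_sdiff.2 ⟨h.2, ?_⟩⟩
      by_contra hd
      exact heY (hclosed e heF hd)

end LooplessMultigraph

/-! ### Cubic graphs with large edge cuts -/

namespace LooplessMultigraph

variable {V ε : Type*} {M : LooplessMultigraph V ε} [DecidableEq V]

/-- A cubic graph on the vertex set `T`, all of whose nontrivial edge cuts have at least three
edges, and at least four unless they separate a single vertex. -/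
structure IsCubicOn (M : LooplessMultigraph V ε) (T : Finset V) : Prop where
  ends_subset : ∀ e ∈ M.edges, M.ends e ⊆ T
  degree_eq : ∀ x ∈ T, #{e ∈ M.edges | x ∈ M.ends e} = 3
  le_boundary : ∀ D ⊆ T, D.Nonempty → (T \ D).Nonempty → 3 ≤ #(M.boundary D)
  card_eq_one : ∀ D ⊆ T, D.Nonempty → (T \ D).Nonempty → #(M.boundary D) = 3 →
    #D = 1 ∨ #(T \ D) = 1

namespace IsCubicOn

variable {T : Finset V} (hT : M.IsCubicOn T)

include hT

lemma degree_le (x : V) : #{e ∈ M.edges | x ∈ M.ends e} ≤ 3 := by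
  by_cases hx : x ∈ T
  · exact (hT.degree_eq x hx).le
  · rw [Finset.filter_false_of_mem fun e he h => hx (hT.ends_subset e he h)]
    simp

lemma three_mul_card {D : Finset V} (hD : D ⊆ T) :
    3 * #D = 2 * #(M.inside D) + #(M.boundary D) := by
  rw [← sum_degree_eq, Finset.sum_congr rfl fun x hx => hT.degree_eq x (hD hx), Finset.sum_const,
    smul_eq_mul, mul_comm]

lemma three_mul_card_self : 3 * #T = 2 * #(M.inside T) := by
  have h1 := hT.three_mul_card subset_rfl
  have h2 : M.boundary T = ∅ :=
    Finset.filter_false_of_mem fun e he h => h.2 (hT.ends_subset e he)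
  rw [h2, Finset.card_empty, add_zero] at h1
  exact h1

/-- In terms of the number `#(M.boundary D) = 3 * #D - 2 * e(D)` of edges leaving `D`, the bound is
`2 ≤ #(M.boundary D)`, or `4 ≤ #(M.boundary D)` if the weight is `e(D) + 2`. The hypothesis on
`T \ D` excludes the one case in which the weight is `e(D) + 2` and three edges leave `D`. -/
lemma two_mul_weight_le {D : Finset V} (hD : D ⊆ T) (hne : D.Nonempty) (hcne : (T \ D).Nonempty)
    (h : #(T \ D) ≠ 1 ∨ #T % 4 = 2) : 2 * M.weight D ≤ 3 * #D := by
  have h1 := hT.three_mul_card hD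
  have h2 := hT.le_boundary D hD hne hcne
  have h3 := hT.card_eq_one D hD hne hcne
  have h4 := Finset.card_sdiff_add_card_eq_card hD
  unfold weight
  split_ifs with hev
  · rw [Nat.even_iff] at hev
    by_cases hb : #(M.boundary D) = 3
    · rcases h3 hb with h5 | h5 <;> omega
    · omega
  · omega

lemma balanced_self (hmod : #T % 4 = 2) : M.Balanced T := by
  intro P
  have h1 := hT.three_mul_card_self
  by_cases hTP : T ∈ P.parts
  · have h2 : P.parts = {T} := by
      refine Finset.eq_singleton_iff_unique_mem.2 ⟨hTP, fun D hD => ?_⟩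
      obtain ⟨x, hx⟩ := P.nonempty_of_mem_parts hD
      exact P.eq_of_mem_parts hD hTP hx (P.subset hD hx)
    rw [h2, Finset.sum_singleton, weight, if_neg]
    rw [Nat.even_iff]
    omega
  · have h2 : ∑ D ∈ P.parts, 2 * M.weight D ≤ ∑ D ∈ P.parts, 3 * #D := by
      refine Finset.sum_le_sum fun D hD => ?_
      refine hT.two_mul_weight_le (P.subset hD) (P.nonempty_of_mem_parts hD) ?_ (Or.inr hmod)
      rw [Finset.sdiff_nonempty]
      intro h
      rw [(P.subset hD).antisymm h] at hD
      exact hTP hD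
    rw [← Finset.mul_sum, ← Finset.mul_sum, P.sum_card_parts] at h2
    omega

/-- Two adjacent vertices are joined by a single edge unless the graph has no further vertices. -/
lemma card_inside_pair {e : ε} (he : e ∈ M.edges) {u v : V} (huv : u ≠ v)
    (hends : M.ends e = {u, v}) (hcne : (T \ {u, v}).Nonempty) : #(M.inside {u, v}) = 1 := by
  have hsub : ({u, v} : Finset V) ⊆ T := hends ▸ hT.ends_subset e he
  have h1 := hT.three_mul_card hsub
  have h2 := hT.le_boundary _ hsub (Finset.insert_nonempty _ _) hcne
  have h3 : 0 < #(M.inside {u, v}) :=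
    Finset.card_pos.2 ⟨e, mem_inside.2 ⟨he, hends.subset⟩⟩
  rw [Finset.card_pair huv] at h1
  omega

/-- The bound on the sum of the weights misses Nebeský's condition by one, and parity closes the
gap. -/
lemma balanced_sdiff_pair (hmod : #T % 4 = 0) {e : ε} (he : e ∈ M.edges) {u v : V} (huv : u ≠ v)
    (hends : M.ends e = {u, v}) (hcne : (T \ {u, v}).Nonempty) : M.Balanced (T \ {u, v}) := by
  have hsub : ({u, v} : Finset V) ⊆ T := hends ▸ hT.ends_subset e he
  intro P
  have h1 := hT.three_mul_card hsub
  have h2 := hT.three_mul_card (D := T \ {u, v}) Finset.sdiff_subset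
  have h3 := Finset.card_sdiff_add_card_eq_card hsub
  have h4 := even_sum_weight (M := M) P
  rw [boundary_sdiff hT.ends_subset] at h2
  rw [hT.card_inside_pair he huv hends hcne, Finset.card_pair huv] at h1
  rw [Finset.card_pair huv] at h3
  rw [Nat.even_iff] at h4
  have h5 : ∑ D ∈ P.parts, 2 * M.weight D ≤ ∑ D ∈ P.parts, 3 * #D := by
    refine Finset.sum_le_sum fun D hD => ?_
    have h6 : {u, v} ⊆ T \ D := by
      rw [Finset.subset_sdiff]
      exact ⟨hsub, (Finset.subset_sdiff.1 (P.subset hD)).2.symm⟩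
    have h7 := Finset.card_le_card h6
    rw [Finset.card_pair huv] at h7
    refine hT.two_mul_weight_le ((P.subset hD).trans Finset.sdiff_subset)
      (P.nonempty_of_mem_parts hD) ?_ (Or.inl (by omega))
    rw [← Finset.card_pos]
    omega
  rw [← Finset.mul_sum, ← Finset.mul_sum, P.sum_card_parts] at h5
  omega

lemma exists_connectedOn_of_mod_eq_two (hmod : #T % 4 = 2) :
    ∃ J ⊆ T, M.ConnectedOn (T \ J) ∧ #(M.inside J) = 0 ∧ 4 * #J = #T + 2 := by
  have hne : T.Nonempty := by
    rw [← Finset.card_pos]; omega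
  obtain ⟨J, hJ⟩ := (hT.balanced_self hmod).exists_isTreeComplement hT.degree_le hne
  refine ⟨J, hJ.subset, hJ.connected, ?_, ?_⟩
  · rw [Finset.card_eq_zero, Finset.eq_empty_iff_forall_notMem]
    intro e he
    exact hJ.indep e (mem_inside.1 he).1 (mem_inside.1 he).2
  · have h1 := hJ.card_eq
    have h2 := hT.three_mul_card_self
    omega

/-- Any edge can be the one induced by the complement of the tree. -/
lemma exists_connectedOn_of_mod_eq_zero (hmod : #T % 4 = 0) (hne : T.Nonempty) :
    ∃ J ⊆ T, M.ConnectedOn (T \ J) ∧ #(M.inside J) = 1 ∧ 4 * #J = #T + 4 := by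
  obtain ⟨x, hx⟩ := hne
  obtain ⟨e, he⟩ : {e ∈ M.edges | x ∈ M.ends e}.Nonempty := by
    rw [← Finset.card_pos, hT.degree_eq x hx]; norm_num
  obtain ⟨he, -⟩ := Finset.mem_filter.1 he
  obtain ⟨u, v, huv, hends⟩ := Finset.card_eq_two.1 (M.card_ends e he)
  have hsub : ({u, v} : Finset V) ⊆ T := hends ▸ hT.ends_subset e he
  have hc := Finset.card_sdiff_add_card_eq_card hsub
  rw [Finset.card_pair huv] at hc
  have hpos : 0 < #T := Finset.card_pos.2 ⟨x, hx⟩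
  have hcne : (T \ {u, v}).Nonempty := by
    rw [← Finset.card_pos]; omega
  have hin := hT.card_inside_pair he huv hends hcne
  obtain ⟨J, hJ⟩ := (hT.balanced_sdiff_pair hmod he huv hends hcne).exists_isTreeComplement
    hT.degree_le hcne
  have hJd : Disjoint ({u, v} : Finset V) J := (Finset.subset_sdiff.1 hJ.subset).2.symm
  refine ⟨{u, v} ∪ J, Finset.union_subset hsub (hJ.subset.trans Finset.sdiff_subset), ?_, ?_, ?_⟩
  · have h := hJ.connected
    rwa [sdiff_sdiff] at h
  · rw [← hin]
    refine congrArg Finset.card (Finset.Subset.antisymm ?_ (inside_mono Finset.subset_union_left))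
    intro f hf
    obtain ⟨hf, hfs⟩ := mem_inside.1 hf
    -- An edge at a vertex of `J` has both ends outside `{u, v}`, hence not both of them in `J`.
    have hfJ : ∀ y ∈ M.ends f, y ∉ J := by
      intro y hy hyJ
      have h1 := ends_subset_of_degIn_eq_three hT.degree_le (hJ.degIn_eq y hyJ) hf hy
      refine hJ.indep f hf fun z hz => ?_
      exact (Finset.mem_union.1 (hfs hz)).resolve_left (Finset.mem_sdiff.1 (h1 hz)).2
    exact mem_inside.2 ⟨hf, fun y hy => (Finset.mem_union.1 (hfs hy)).resolve_right (hfJ y hy)⟩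
  · have h1 := hJ.card_eq
    have h2 := hT.three_mul_card hsub
    have h3 := hT.three_mul_card (D := T \ {u, v}) Finset.sdiff_subset
    rw [boundary_sdiff hT.ends_subset] at h3
    rw [hin, Finset.card_pair huv] at h2
    rw [Finset.card_union_of_disjoint hJd, Finset.card_pair huv]
    omega

end IsCubicOn

end LooplessMultigraph

/-! ### Connectedness and cycles in induced subgraphs -/

namespace Graph

variable {α β : Type*} {G : Graph α β}

lemma Inc.isLink_of_ne {e : β} {x y : α} (hx : G.Inc e x) (hy : G.Inc e y) (hne : x ≠ y) :
    G.IsLink e x y := by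
  obtain ⟨z, hz⟩ := hx
  rcases hy.eq_or_eq_of_isLink hz with rfl | rfl
  · exact absurd rfl hne
  · exact hz

lemma IsConnected.subset_of_closed {H : Graph α β} (hH : H.IsConnected) {Y : Set α}
    (hY : ∀ x y, H.Adj x y → x ∈ Y → y ∈ Y) {x : α} (hx : x ∈ V(H)) (hxY : x ∈ Y) : V(H) ⊆ Y := by
  intro y hy
  have h := hH.2 x hx y hy
  induction h with
  | refl => exact hxY
  | tail _ hadj ih => exact hY _ _ hadj (ih hadj.left_mem)

lemma isConnected_of_closed {H : Graph α β} (hne : V(H).Nonempty)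
    (h : ∀ Y ⊆ V(H), Y.Nonempty → (∀ x y, H.Adj x y → x ∈ Y → y ∈ Y) → Y = V(H)) :
    H.IsConnected := by
  refine ⟨hne, fun x hx y hy => ?_⟩
  have h1 : {z | z ∈ V(H) ∧ Relation.ReflTransGen H.Adj x z} = V(H) := by
    refine h _ (fun z hz => hz.1) ⟨x, hx, Relation.ReflTransGen.refl⟩ fun z w hadj hz => ?_
    exact ⟨hadj.right_mem, hz.2.tail hadj⟩
  rw [← h1] at hy
  exact hy.2

lemma IsConnected.eq_of_isComponentOf {G H : Graph α β} (hG : G.IsConnected)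
    (hH : H.IsComponentOf G) : H = G := by
  obtain ⟨x, hx⟩ := hH.2.1
  refine hH.1.isInducedSubgraph.ext_of_vertexSet (hH.1.vertexSet_mono.antisymm ?_)
  exact hG.subset_of_closed (fun y z hadj hy => (hH.1.mem_iff_of_adj hadj).1 hy)
    (hH.1.vertexSet_mono hx) hx

lemma exists_isComponentOf {C H : Graph α β} (hC : C.IsConnected) (hCH : C ≤ H) :
    ∃ H₁ : Graph α β, H₁.IsComponentOf H ∧ C ≤ H₁ := by
  obtain ⟨x, hx⟩ := hC.1
  set S : Set α := {y | y ∈ V(H) ∧ Relation.ReflTransGen H.Adj x y} with hS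
  have hSV : S ⊆ V(H) := fun y hy => hy.1
  have hxS : x ∈ S := ⟨hCH.vertexSet_mono hx, Relation.ReflTransGen.refl⟩
  have hstep : ∀ y z, H.Adj y z → y ∈ S → z ∈ S := fun y z hadj hy =>
    ⟨hadj.right_mem, hy.2.tail hadj⟩
  have hclosed : H.induce S ≤c H := by
    refine IsClosedSubgraph.mk' (induce_le hSV) ?_
    rintro e y ⟨z, hz⟩ hy
    exact ⟨y, z, hz, hy, hstep y z hz.adj hy⟩
  refine ⟨H.induce S, ⟨hclosed, isConnected_of_closed ⟨x, hxS⟩ ?_⟩, ?_⟩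
  · intro Y hYS hYne hYcl
    have hYcl' : ∀ y z, H.Adj y z → y ∈ Y → z ∈ Y := by
      rintro y z ⟨e, he⟩ hy
      exact hYcl y z ⟨e, he, hYS hy, hstep y z he.adj (hYS hy)⟩ hy
    have hreach : ∀ y ∈ Y, ∀ z, Relation.ReflTransGen H.Adj y z → z ∈ Y := by
      intro y hy z hz
      induction hz with
      | refl => exact hy
      | tail _ hadj ih => exact hYcl' _ _ hadj ih
    obtain ⟨y, hy⟩ := hYne
    have hxY := hreach y hy x (Std.Symm.symm _ _ (hYS hy).2)
    exact hYS.antisymm fun z hz => hreach x hxY z hz.2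
  · refine hclosed.isInducedSubgraph.le_of_le_subset hCH fun y hy => ?_
    exact hC.subset_of_closed (Y := S) (fun z w hadj hz => hstep z w (hadj.mono hCH) hz) hx hxS hy

open scoped Classical in
/-- The multigraph obtained from a finite graph by forgetting its loops. -/
noncomputable def looplessPart (G : Graph α β) (hV : V(G).Finite) (hE : E(G).Finite) :
    LooplessMultigraph α β where
  edges := {e ∈ hE.toFinset | ∀ x, ¬ G.IsLoopAt e x}
  ends e := {x ∈ hV.toFinset | G.Inc e x}
  card_ends e he := by
    simp only [Finset.mem_filter, Set.Finite.mem_toFinset] at he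
    obtain ⟨x, y, hxy⟩ := G.exists_isLink_of_mem_edgeSet he.1
    rw [Finset.card_eq_two]
    refine ⟨x, y, fun h => he.2 x ?_, ?_⟩
    · subst h
      exact hxy
    · ext z
      simp only [Finset.mem_filter, Set.Finite.mem_toFinset, Finset.mem_insert,
        Finset.mem_singleton]
      constructor
      · rintro ⟨-, hz⟩
        exact hz.eq_or_eq_of_isLink hxy
      · rintro (rfl | rfl)
        · exact ⟨hxy.left_mem, hxy.inc_left⟩
        · exact ⟨hxy.right_mem, hxy.inc_right⟩

variable {hV : V(G).Finite} {hE : E(G).Finite}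

lemma mem_edges_looplessPart {e : β} :
    e ∈ (G.looplessPart hV hE).edges ↔ e ∈ E(G) ∧ ∀ x, ¬ G.IsLoopAt e x := by
  simp [looplessPart]

lemma mem_ends_looplessPart {e : β} {x : α} :
    x ∈ (G.looplessPart hV hE).ends e ↔ G.Inc e x := by
  simp only [looplessPart, Finset.mem_filter, Set.Finite.mem_toFinset, and_iff_right_iff_imp]
  exact fun h => h.vertex_mem

lemma ends_looplessPart_subset (e : β) : (G.looplessPart hV hE).ends e ⊆ hV.toFinset := by
  intro x hx
  exact hV.mem_toFinset.2 (mem_ends_looplessPart.1 hx).vertex_mem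

lemma ends_looplessPart_subset_iff {e : β} {x y : α} (h : G.IsLink e x y) {D : Finset α} :
    (G.looplessPart hV hE).ends e ⊆ D ↔ x ∈ D ∧ y ∈ D := by
  constructor
  · intro hs
    exact ⟨hs (mem_ends_looplessPart.2 h.inc_left), hs (mem_ends_looplessPart.2 h.inc_right)⟩
  · rintro ⟨hx, hy⟩ z hz
    rcases (mem_ends_looplessPart.1 hz).eq_or_eq_of_isLink h with rfl | rfl
    · exact hx
    · exact hy

lemma mem_edges_of_isLink_ne {e : β} {x y : α} (h : G.IsLink e x y) (hne : x ≠ y) :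
    e ∈ (G.looplessPart hV hE).edges := by
  refine mem_edges_looplessPart.2 ⟨h.edge_mem, fun z hz => hne ?_⟩
  exact (hz.eq_of_inc h.inc_left).symm.trans (hz.eq_of_inc h.inc_right)

lemma hasCycle_induce_of_isLoopAt {e : β} {v : α} (h : G.IsLoopAt e v) {D : Set α} (hv : v ∈ D) :
    (G.induce D).HasCycle := by
  refine ⟨(G.induce {v}).restrict {e}, ⟨?_, ?_⟩, ?_, isConnected_of_closed ?_ ?_, ?_⟩
  · exact Set.singleton_subset_iff.2 hv
  · rintro f x y ⟨-, hl, hx, hy⟩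
    rw [Set.mem_singleton_iff] at hx hy
    subst hx hy
    exact ⟨hl, hv, hv⟩
  · exact Set.finite_singleton v
  · exact Set.singleton_nonempty v
  · intro Y hY hne _
    exact (Set.subset_singleton_iff_eq.1 hY).resolve_left hne.ne_empty
  · intro x hx
    have hx' : x = v := hx
    subst hx'
    have h1 : ((G.induce {x}).restrict {e}).incidenceSet x = {e} := by
      ext f
      simp only [mem_incidenceSet, restrict_inc, Set.mem_singleton_iff]
      refine ⟨fun h => h.2, ?_⟩
      rintro rfl
      exact ⟨⟨x, h, rfl, rfl⟩, rfl⟩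
    have h2 : ((G.induce {x}).restrict {e}).loopSet x = {e} := by
      ext f
      simp only [mem_loopSet, restrict_isLoopAt, Set.mem_singleton_iff]
      refine ⟨fun h => h.2, ?_⟩
      rintro rfl
      exact ⟨⟨h, rfl, rfl⟩, rfl⟩
    rw [degree, h1, h2, Set.encard_singleton]
    norm_num

variable [DecidableEq α]

lemma isConnected_induce {A : Finset α} (hA : (G.looplessPart hV hE).ConnectedOn A) :
    (G.induce (A : Set α)).IsConnected := by
  classical
  refine isConnected_of_closed (Finset.coe_nonempty.2 hA.1) fun Y hYA hYne hcl => ?_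
  have hYA' : Y ⊆ (A : Set α) := hYA
  have h : {x ∈ A | x ∈ Y} = A := by
    refine hA.2 _ (Finset.filter_subset _ _) ?_ fun e he hd => ?_
    · obtain ⟨y, hy⟩ := hYne
      exact ⟨y, Finset.mem_filter.2 ⟨hYA' hy, hy⟩⟩
    · obtain ⟨v, hv, hvY⟩ := Finset.not_disjoint_iff.1 hd
      have hvY := Finset.mem_filter.1 hvY
      obtain ⟨-, hs⟩ := LooplessMultigraph.mem_inside.1 he
      intro w hw
      refine Finset.mem_filter.2 ⟨hs hw, ?_⟩
      by_cases hvw : v = w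
      · exact hvw ▸ hvY.2
      · have hl := (mem_ends_looplessPart.1 hv).isLink_of_ne (mem_ends_looplessPart.1 hw) hvw
        exact hcl v w ⟨e, hl, hvY.1, hs hw⟩ hvY.2
  refine hYA.antisymm fun x hx => ?_
  have hx' : x ∈ A := hx
  rw [← h] at hx'
  exact (Finset.mem_filter.1 hx').2

lemma hasCycle_induce_of_card_le {D : Finset α} (hD : D.Nonempty)
    (hc : #D ≤ #((G.looplessPart hV hE).inside D)) : (G.induce (D : Set α)).HasCycle := by
  obtain ⟨D', hDD, F, -, hDne, hF, hdeg, hconn⟩ :=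
    LooplessMultigraph.exists_two_regular (subset_refl _) hD hc
  have hFlink : ∀ e ∈ F, ∀ x, G.Inc e x → ((G.induce (D' : Set α)).restrict F).Inc e x := by
    rintro e he x ⟨y, hxy⟩
    have hs := (ends_looplessPart_subset_iff hxy).1 (LooplessMultigraph.mem_inside.1 (hF he)).2
    exact ⟨y, he, hxy, hs.1, hs.2⟩
  refine ⟨(G.induce (D' : Set α)).restrict F, ⟨?_, ?_⟩, ?_, isConnected_of_closed ?_ ?_, ?_⟩
  · exact Finset.coe_subset.2 hDD
  · rintro e x y ⟨-, hl, hx, hy⟩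
    exact ⟨hl, hDD hx, hDD hy⟩
  · exact D'.finite_toSet
  · exact Finset.coe_nonempty.2 hDne
  · intro Y hYD hYne hcl
    classical
    have hYD' : Y ⊆ (D' : Set α) := hYD
    have h : {x ∈ D' | x ∈ Y} = D' := by
      refine hconn _ (Finset.filter_subset _ _) ?_ fun e he hd => ?_
      · obtain ⟨y, hy⟩ := hYne
        exact ⟨y, Finset.mem_filter.2 ⟨hYD' hy, hy⟩⟩
      · obtain ⟨v, hv, hvY⟩ := Finset.not_disjoint_iff.1 hd
        have hvY := Finset.mem_filter.1 hvY
        obtain ⟨-, hs⟩ := LooplessMultigraph.mem_inside.1 (hF he)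
        intro w hw
        refine Finset.mem_filter.2 ⟨hs hw, ?_⟩
        by_cases hvw : v = w
        · exact hvw ▸ hvY.2
        · have hl := (mem_ends_looplessPart.1 hv).isLink_of_ne (mem_ends_looplessPart.1 hw) hvw
          exact hcl v w ⟨e, he, hl, hvY.1, hs hw⟩ hvY.2
    refine hYD.antisymm fun x hx => ?_
    have hx' : x ∈ D' := hx
    rw [← h] at hx'
    exact (Finset.mem_filter.1 hx').2
  · intro v hv
    have hv' : v ∈ D' := hv
    have h1 : ((G.induce (D' : Set α)).restrict F).incidenceSet v =
        ({e ∈ F | v ∈ (G.looplessPart hV hE).ends e} : Finset β) := by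
      ext e
      rw [mem_incidenceSet, Finset.mem_coe, Finset.mem_filter, mem_ends_looplessPart]
      constructor
      · rintro ⟨w, he, hl, -⟩
        exact ⟨he, hl.inc_left⟩
      · rintro ⟨he, hi⟩
        exact hFlink e he v hi
    have h2 : ((G.induce (D' : Set α)).restrict F).loopSet v = ∅ := by
      rw [Set.eq_empty_iff_forall_notMem]
      rintro e ⟨he, hl, -⟩
      exact (mem_edges_looplessPart.1 (LooplessMultigraph.mem_inside.1 (hF he)).1).2 v hl
    rw [degree, h1, h2, Set.encard_coe_eq_coe_finsetCard, hdeg v hv']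
    simp

lemma not_hasCycle_induce (hloop : ∀ e x, ¬ G.IsLoopAt e x) {A : Finset α}
    (hA : (G.looplessPart hV hE).ConnectedOn A)
    (hc : #((G.looplessPart hV hE).inside A) < #A) : ¬ (G.induce (A : Set α)).HasCycle := by
  classical
  rintro ⟨C, hCA, -, hconn, hdeg⟩
  have hVC : V(C) ⊆ (A : Set α) := hCA.vertexSet_mono
  have hlink : ∀ e x y, C.IsLink e x y → G.IsLink e x y := fun e x y h => (h.mono hCA).1
  set U : Finset α := {x ∈ A | x ∈ V(C)} with hU
  have hmemU : ∀ x, x ∈ U ↔ x ∈ V(C) := fun x =>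
    ⟨fun h => (Finset.mem_filter.1 h).2, fun h => Finset.mem_filter.2 ⟨hVC h, h⟩⟩
  set F : Finset β := {e ∈ (G.looplessPart hV hE).edges | e ∈ E(C)} with hF
  have hFU : F ⊆ (G.looplessPart hV hE).inside U := by
    intro e he
    obtain ⟨he1, he2⟩ := Finset.mem_filter.1 he
    obtain ⟨x, y, hxy⟩ := C.exists_isLink_of_mem_edgeSet he2
    exact LooplessMultigraph.mem_inside.2 ⟨he1, (ends_looplessPart_subset_iff (hlink _ _ _ hxy)).2
      ⟨(hmemU x).2 hxy.left_mem, (hmemU y).2 hxy.right_mem⟩⟩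
  have h1 : ∀ x ∈ U, #{e ∈ F | x ∈ (G.looplessPart hV hE).ends e} = 2 := by
    intro x hx
    have h2 := hdeg x ((hmemU x).1 hx)
    have h3 : C.incidenceSet x =
        ({e ∈ F | x ∈ (G.looplessPart hV hE).ends e} : Finset β) := by
      ext e
      rw [mem_incidenceSet, Finset.mem_coe, Finset.mem_filter, mem_ends_looplessPart,
        Finset.mem_filter, mem_edges_looplessPart]
      constructor
      · rintro ⟨y, hy⟩
        exact ⟨⟨⟨(hlink _ _ _ hy).edge_mem, hloop e⟩, hy.edge_mem⟩, (hlink _ _ _ hy).inc_left⟩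
      · rintro ⟨⟨-, heC⟩, hi⟩
        obtain ⟨y, z, hyz⟩ := C.exists_isLink_of_mem_edgeSet heC
        rcases hi.eq_or_eq_of_isLink (hlink _ _ _ hyz) with rfl | rfl
        · exact hyz.inc_left
        · exact hyz.inc_right
    have h4 : C.loopSet x = ∅ := by
      rw [Set.eq_empty_iff_forall_notMem]
      intro e he
      exact hloop e x (hlink e x x he)
    rw [degree, h3, h4, Set.encard_coe_eq_coe_finsetCard, Set.encard_empty, add_zero] at h2
    exact_mod_cast h2
  have h2 := LooplessMultigraph.sum_card_filter_mem_ends_of_subset hFU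
  rw [Finset.sum_congr rfl h1, Finset.sum_const, smul_eq_mul] at h2
  have h3 := Finset.card_le_card hFU
  obtain ⟨x, hx⟩ := hconn.1
  have h4 := hA.card_add_card_inside_le (U := U) (Finset.filter_subset _ _) ⟨x, (hmemU x).2 hx⟩
  omega

lemma isCycleSeparating_boundary {D : Finset α} (h₁ : (G.induce (D : Set α)).HasCycle)
    (hD : D ⊆ hV.toFinset)
    (h₂ : (G.induce ((hV.toFinset \ D : Finset α) : Set α)).HasCycle) :
    G.IsCycleSeparating ((G.looplessPart hV hE).boundary D : Set β) := by
  set B : Set β := ((G.looplessPart hV hE).boundary D : Set β) with hB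
  have hmemB : ∀ e, e ∈ B ↔ e ∈ (G.looplessPart hV hE).edges ∧
      ¬ Disjoint ((G.looplessPart hV hE).ends e) D ∧ ¬ (G.looplessPart hV hE).ends e ⊆ D := by
    intro e
    rw [hB, Finset.mem_coe, LooplessMultigraph.boundary, Finset.mem_filter]
  have hstep : ∀ x y, (G.deleteEdges B).Adj x y → x ∈ (D : Set α) → y ∈ (D : Set α) := by
    rintro x y ⟨e, hl, heB⟩ hx
    by_contra hy
    refine heB ((hmemB e).2 ⟨mem_edges_of_isLink_ne hl (fun h => hy (h ▸ hx)), ?_, fun hs => ?_⟩)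
    · exact Finset.not_disjoint_iff.2 ⟨x, mem_ends_looplessPart.2 hl.inc_left, hx⟩
    · exact hy (hs (mem_ends_looplessPart.2 hl.inc_right))
  obtain ⟨C₁, hC₁, hc₁⟩ := h₁
  obtain ⟨C₂, hC₂, hc₂⟩ := h₂
  have hV₁ : V(C₁) ⊆ (D : Set α) := hC₁.vertexSet_mono
  have hV₂ : V(C₂) ⊆ ((hV.toFinset \ D : Finset α) : Set α) := hC₂.vertexSet_mono
  have hle₁ : C₁ ≤ G.deleteEdges B := by
    refine ⟨fun x hx => hV.mem_toFinset.1 (hD (hV₁ hx)), fun e x y hl => ⟨(hl.mono hC₁).1, ?_⟩⟩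
    intro he
    exact ((hmemB e).1 he).2.2 ((ends_looplessPart_subset_iff (hl.mono hC₁).1).2
      ⟨hV₁ hl.left_mem, hV₁ hl.right_mem⟩)
  have hle₂ : C₂ ≤ G.deleteEdges B := by
    refine ⟨fun x hx => hV.mem_toFinset.1 (Finset.mem_sdiff.1 (hV₂ hx)).1,
      fun e x y hl => ⟨(hl.mono hC₂).1, fun he => ?_⟩⟩
    obtain ⟨v, hv, hvD⟩ := Finset.not_disjoint_iff.1 ((hmemB e).1 he).2.1
    rcases (mem_ends_looplessPart.1 hv).eq_or_eq_of_isLink (hl.mono hC₂).1 with rfl | rfl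
    · exact (Finset.mem_sdiff.1 (hV₂ hl.left_mem)).2 hvD
    · exact (Finset.mem_sdiff.1 (hV₂ hl.right_mem)).2 hvD
  -- No connected subgraph of `G - B` contains both cycles.
  have hsep : ∀ H : Graph α β, H ≤ G.deleteEdges B → H.IsConnected → V(C₁) ⊆ V(H) →
      ¬ V(C₂) ⊆ V(H) := by
    intro H hH hconn h1 h2
    obtain ⟨x, hx⟩ := hc₁.2.1.1
    obtain ⟨y, hy⟩ := hc₂.2.1.1
    have h := hconn.subset_of_closed (Y := (D : Set α))
      (fun z w hadj hz => hstep z w (hadj.mono hH) hz) (h1 hx) (hV₁ hx) (h2 hy)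
    exact (Finset.mem_sdiff.1 (hV₂ hy)).2 h
  obtain ⟨H₁, hH₁, hCH₁⟩ := exists_isComponentOf hc₁.2.1 hle₁
  obtain ⟨H₂, hH₂, hCH₂⟩ := exists_isComponentOf hc₂.2.1 hle₂
  refine ⟨fun e he => (mem_edges_looplessPart.1 ((hmemB e).1 he).1).1,
    fun hcon => hsep _ le_rfl hcon hle₁.vertexSet_mono hle₂.vertexSet_mono,
    H₁, H₂, ?_, hH₁, hH₂, ⟨C₁, hCH₁, hc₁⟩, ⟨C₂, hCH₂, hc₂⟩⟩
  rintro rfl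
  exact hsep _ hH₁.1.le hH₁.2 hCH₁.vertexSet_mono hCH₂.vertexSet_mono

lemma IsCyclicallyEdgeConnected.le_card_boundary {k : ℕ} (hG : G.IsCyclicallyEdgeConnected k)
    {D : Finset α} (h₁ : (G.induce (D : Set α)).HasCycle) (hD : D ⊆ hV.toFinset)
    (h₂ : (G.induce ((hV.toFinset \ D : Finset α) : Set α)).HasCycle) :
    k ≤ #((G.looplessPart hV hE).boundary D) := by
  by_contra! hlt
  refine hG.2 _ ?_ (isCycleSeparating_boundary (hE := hE) h₁ hD h₂)
  rw [Set.encard_coe_eq_coe_finsetCard]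
  exact_mod_cast hlt

end Graph

/-! ### Coherent decycling partitions of cyclically 4-edge-connected cubic graphs -/

namespace Graph

variable {α β : Type*} {G : Graph α β} {hV : V(G).Finite} {hE : E(G).Finite}

lemma incidenceSet_eq_union (v : α) [DecidableEq α] :
    G.incidenceSet v =
      (({e ∈ (G.looplessPart hV hE).edges | v ∈ (G.looplessPart hV hE).ends e} : Finset β) :
        Set β) ∪ G.loopSet v := by
  ext e
  rw [Set.mem_union, mem_incidenceSet, Finset.mem_coe, Finset.mem_filter, mem_edges_looplessPart,
    mem_ends_looplessPart, mem_loopSet]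
  constructor
  · intro h
    by_cases hl : G.IsLoopAt e v
    · exact Or.inr hl
    · exact Or.inl ⟨⟨h.edge_mem, fun x hx => hl ((hx.eq_of_inc h) ▸ hx)⟩, h⟩
  · rintro (h | h)
    · exact h.2
    · exact h.inc

variable [DecidableEq α]

/-- Each loop at a vertex of a cubic graph takes two of the three units of its degree. -/
lemma IsCubic.card_add_two_mul_ncard_loopSet (hG : G.IsCubic) {v : α} (hv : v ∈ V(G)) :
    #{e ∈ (G.looplessPart hV hE).edges | v ∈ (G.looplessPart hV hE).ends e} +
      2 * (G.loopSet v).ncard = 3 := by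
  have h1 := hG v hv
  have hfin : (G.loopSet v).Finite :=
    hE.subset ((G.loopSet_subset_incidenceSet v).trans (G.incidenceSet_subset_edgeSet v))
  have hd : Disjoint
      (({e ∈ (G.looplessPart hV hE).edges | v ∈ (G.looplessPart hV hE).ends e} : Finset β) : Set β)
      (G.loopSet v) := by
    rw [Set.disjoint_left]
    intro e he hl
    rw [Finset.mem_coe, Finset.mem_filter, mem_edges_looplessPart] at he
    exact he.1.2 v hl
  rw [degree, incidenceSet_eq_union (hV := hV) (hE := hE), Set.encard_union_eq hd,
    Set.encard_coe_eq_coe_finsetCard, ← hfin.cast_ncard_eq] at h1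
  have h2 : #{e ∈ (G.looplessPart hV hE).edges | v ∈ (G.looplessPart hV hE).ends e} +
      (G.loopSet v).ncard + (G.loopSet v).ncard = 3 := by exact_mod_cast h1
  omega

/-- A loop would be separated by a single edge from the rest of the graph, which contains a cycle
as well. -/
lemma IsCyclicallyEdgeConnected.not_isLoopAt (hV : V(G).Finite) (hE : E(G).Finite)
    (hG : G.IsCyclicallyEdgeConnected 4) (hcubic : G.IsCubic) (e : β) (v : α) :
    ¬ G.IsLoopAt e v := by
  intro hl
  have hdegle : ∀ w ∈ V(G), #{e ∈ (G.looplessPart hV hE).edges |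
      w ∈ (G.looplessPart hV hE).ends e} ≤ 3 := fun w hw => by
    have := hcubic.card_add_two_mul_ncard_loopSet (hV := hV) (hE := hE) hw
    omega
  have hv := hl.vertex_mem
  have hvV : {v} ⊆ hV.toFinset := Finset.singleton_subset_iff.2 (hV.mem_toFinset.2 hv)
  have h1 := hcubic.card_add_two_mul_ncard_loopSet (hV := hV) (hE := hE) hv
  have hfin : (G.loopSet v).Finite :=
    hE.subset ((G.loopSet_subset_incidenceSet v).trans (G.incidenceSet_subset_edgeSet v))
  have h2 : 0 < (G.loopSet v).ncard := (Set.ncard_pos hfin).2 ⟨e, hl⟩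
  have hb : #((G.looplessPart hV hE).boundary {v}) ≤ 1 := by
    have h3 := (G.looplessPart hV hE).sum_degree_eq {v}
    rw [Finset.sum_singleton] at h3
    omega
  set W : Finset α := hV.toFinset \ {v} with hW
  have hWV : W ⊆ hV.toFinset := Finset.sdiff_subset
  have hWne : W.Nonempty := by
    obtain ⟨f, hf⟩ : {e ∈ (G.looplessPart hV hE).edges |
        v ∈ (G.looplessPart hV hE).ends e}.Nonempty := by
      rw [← Finset.card_pos]; omega
    obtain ⟨w, hw, hne⟩ := LooplessMultigraph.exists_ne_mem_ends (Finset.mem_filter.1 hf).1 v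
    exact ⟨w, Finset.mem_sdiff.2 ⟨ends_looplessPart_subset f hw, by simpa using hne⟩⟩
  have hWc : (G.induce (W : Set α)).HasCycle := by
    by_cases hloop : ∃ f w, w ∈ W ∧ G.IsLoopAt f w
    · obtain ⟨f, w, hw, hfw⟩ := hloop
      exact hasCycle_induce_of_isLoopAt hfw hw
    push Not at hloop
    have hdeg : ∀ w ∈ W, #{e ∈ (G.looplessPart hV hE).edges |
        w ∈ (G.looplessPart hV hE).ends e} = 3 := by
      intro w hw
      have h3 := hcubic.card_add_two_mul_ncard_loopSet (hV := hV) (hE := hE)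
        (hV.mem_toFinset.1 (hWV hw))
      have h4 : G.loopSet w = ∅ :=
        Set.eq_empty_iff_forall_notMem.2 fun f hf => hloop f w hw hf
      rw [h4, Set.ncard_empty] at h3
      omega
    have h3 := (G.looplessPart hV hE).sum_degree_eq W
    rw [Finset.sum_congr rfl hdeg, Finset.sum_const, smul_eq_mul, hW,
      LooplessMultigraph.boundary_sdiff fun e _ => ends_looplessPart_subset e, ← hW] at h3
    have h4 := hWne.card_pos
    exact hasCycle_induce_of_card_le hWne (hV := hV) (hE := hE) (by omega)
  have h5 := hG.le_card_boundary (hE := hE)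
    (hasCycle_induce_of_isLoopAt hl (by simp) : (G.induce (({v} : Finset α) : Set α)).HasCycle)
    hvV hWc
  omega


/-- If fewer than four edges leave `D`, then `D` or its complement induces a forest, and more than
`#D + 1`, respectively `#(V(G) \ D) + 1`, edges leave a forest in a cubic graph. -/
lemma IsCyclicallyEdgeConnected.isCubicOn_looplessPart (hV : V(G).Finite) (hE : E(G).Finite)
    (hG : G.IsCyclicallyEdgeConnected 4) (hcubic : G.IsCubic) :
    (G.looplessPart hV hE).IsCubicOn hV.toFinset := by
  have hdeg : ∀ x ∈ hV.toFinset, #{e ∈ (G.looplessPart hV hE).edges |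
      x ∈ (G.looplessPart hV hE).ends e} = 3 := by
    intro x hx
    have h1 := hcubic.card_add_two_mul_ncard_loopSet (hV := hV) (hE := hE) (hV.mem_toFinset.1 hx)
    have h2 : G.loopSet x = ∅ :=
      Set.eq_empty_iff_forall_notMem.2 fun f hf => hG.not_isLoopAt hV hE hcubic f x hf
    rw [h2, Set.ncard_empty] at h1
    omega
  have hcount : ∀ D ⊆ hV.toFinset, 3 * #D =
      2 * #((G.looplessPart hV hE).inside D) + #((G.looplessPart hV hE).boundary D) := by
    intro D hD
    rw [← LooplessMultigraph.sum_degree_eq, Finset.sum_congr rfl fun x hx => hdeg x (hD hx),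
      Finset.sum_const, smul_eq_mul, mul_comm]
  have hcut : ∀ D ⊆ hV.toFinset, D.Nonempty → (hV.toFinset \ D).Nonempty →
      4 ≤ #((G.looplessPart hV hE).boundary D) ∨
      #D + 2 ≤ #((G.looplessPart hV hE).boundary D) ∨
      #(hV.toFinset \ D) + 2 ≤ #((G.looplessPart hV hE).boundary D) := by
    intro D hD hne hcne
    have h1 := hcount D hD
    have h2 := hcount (hV.toFinset \ D) Finset.sdiff_subset
    rw [LooplessMultigraph.boundary_sdiff fun e _ => ends_looplessPart_subset e] at h2
    by_cases h3 : #D ≤ #((G.looplessPart hV hE).inside D)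
    · by_cases h4 : #(hV.toFinset \ D) ≤ #((G.looplessPart hV hE).inside (hV.toFinset \ D))
      · exact Or.inl (hG.le_card_boundary (hasCycle_induce_of_card_le hne h3) hD
          (hasCycle_induce_of_card_le hcne h4))
      · omega
    · omega
  refine ⟨fun e _ => ends_looplessPart_subset e, hdeg, fun D hD hne hcne => ?_,
    fun D hD hne hcne hb => ?_⟩
  · have h1 := hne.card_pos
    have h2 := hcne.card_pos
    have := hcut D hD hne hcne
    omega
  · have h1 := hne.card_pos
    have h2 := hcne.card_pos
    have := hcut D hD hne hcne
    omega

lemma edgeSet_induce_eq_inside (hloop : ∀ e x, ¬ G.IsLoopAt e x) (D : Finset α) :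
    E(G.induce (D : Set α)) = ((G.looplessPart hV hE).inside D : Set β) := by
  ext e
  rw [Finset.mem_coe, LooplessMultigraph.mem_inside]
  constructor
  · rintro ⟨x, y, hl, hx, hy⟩
    exact ⟨mem_edges_looplessPart.2 ⟨hl.edge_mem, hloop e⟩,
      (ends_looplessPart_subset_iff hl).2 ⟨hx, hy⟩⟩
  · rintro ⟨he, hs⟩
    obtain ⟨x, y, hl⟩ := G.exists_isLink_of_mem_edgeSet (mem_edges_looplessPart.1 he).1
    obtain ⟨hx, hy⟩ := (ends_looplessPart_subset_iff hl).1 hs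
    exact ⟨x, y, hl, hx, hy⟩

/-- At most `3 * #K` edges of a cubic graph meet a decycling set `K`, and the other edges form
a forest. -/
lemma IsDecycling.card_add_two_le (hT : (G.looplessPart hV hE).IsCubicOn hV.toFinset)
    (hne : V(G).Nonempty) {K : Finset α} (hK : G.IsDecycling (K : Set α)) :
    #hV.toFinset + 2 ≤ 4 * #K := by
  have hKV : K ⊆ hV.toFinset := fun x hx => hV.mem_toFinset.2 (hK.1 hx)
  have h1 := hT.three_mul_card hKV
  have h2 := hT.three_mul_card (D := hV.toFinset \ K) Finset.sdiff_subset
  have h3 := Finset.card_sdiff_add_card_eq_card hKV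
  rw [LooplessMultigraph.boundary_sdiff fun e _ => ends_looplessPart_subset e] at h2
  rcases (hV.toFinset \ K).eq_empty_or_nonempty with h4 | h4
  · have h5 : 0 < #hV.toFinset := Finset.card_pos.2 (hV.toFinset_nonempty.2 hne)
    rw [h4, Finset.card_empty] at h3
    omega
  · have h5 : ¬ #(hV.toFinset \ K) ≤ #((G.looplessPart hV hE).inside (hV.toFinset \ K)) := by
      intro h
      have h6 := hasCycle_induce_of_card_le h4 h
      rw [Finset.coe_sdiff, hV.coe_toFinset] at h6
      exact hK.2 h6
    omega

/-- A set that leaves a connected graph, spans at most one edge, and has the size that makes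
this graph a tree is the smaller side of a coherent decycling partition. -/
lemma isCoherentDecyclingPartition_of_connectedOn
    (hT : (G.looplessPart hV hE).IsCubicOn hV.toFinset) (hloop : ∀ e x, ¬ G.IsLoopAt e x)
    {J : Finset α} (hJ : J ⊆ hV.toFinset)
    (hconn : (G.looplessPart hV hE).ConnectedOn (hV.toFinset \ J))
    (hin : #((G.looplessPart hV hE).inside J) ≤ 1)
    (hcard : 4 * #J = #hV.toFinset + 2 + 2 * #((G.looplessPart hV hE).inside J)) :
    G.IsCoherentDecyclingPartition (V(G) \ J) (J : Set α) := by
  have hA : ((hV.toFinset \ J : Finset α) : Set α) = V(G) \ J := by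
    rw [Finset.coe_sdiff, hV.coe_toFinset]
  have hJV : (J : Set α) ⊆ V(G) := fun x hx => hV.mem_toFinset.1 (hJ hx)
  have h1 := hT.three_mul_card hJ
  have h2 := hT.three_mul_card (D := hV.toFinset \ J) Finset.sdiff_subset
  have h3 := Finset.card_sdiff_add_card_eq_card hJ
  rw [LooplessMultigraph.boundary_sdiff hT.ends_subset] at h2
  have hforest : ¬ (G.induce (V(G) \ J)).HasCycle := by
    rw [← hA]
    exact not_hasCycle_induce hloop hconn (by omega)
  have htree : (G.induce (V(G) \ J)).IsConnected := by
    rw [← hA]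
    exact isConnected_induce hconn
  refine ⟨⟨Set.sdiff_union_of_subset hJV, Set.disjoint_sdiff_left, ?_, ?_, ⟨⟨hJV, hforest⟩, ?_⟩, ?_,
    hforest, ?_⟩, htree, hforest⟩
  · rw [← hA]
    exact Finset.coe_nonempty.2 hconn.1
  · rw [Finset.coe_nonempty, ← Finset.card_pos]
    omega
  · intro K hK
    have hKfin : K.Finite := hV.subset hK.1
    have hK' : G.IsDecycling (hKfin.toFinset : Set α) := by rwa [hKfin.coe_toFinset]
    have hVne : V(G).Nonempty := by
      obtain ⟨x, hx⟩ := hconn.1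
      exact ⟨x, hV.mem_toFinset.1 (Finset.mem_sdiff.1 hx).1⟩
    have h4 := hK'.card_add_two_le hT hVne
    rw [← hKfin.coe_toFinset, Set.encard_coe_eq_coe_finsetCard, Set.encard_coe_eq_coe_finsetCard]
    exact_mod_cast (by omega : #J ≤ #hKfin.toFinset)
  · rw [IsIndependent, IsNearIndependent, edgeSet_induce_eq_inside (hV := hV) (hE := hE) hloop,
      Set.encard_coe_eq_coe_finsetCard, Finset.coe_eq_empty, ← Finset.card_eq_zero]
    rcases Nat.le_one_iff_eq_zero_or_eq_one.1 hin with h | h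
    · exact Or.inl h
    · exact Or.inr (by rw [h]; rfl)
  · have h4 : {H : Graph α β | H.IsComponentOf (G.induce (V(G) \ J))} ⊆
        {G.induce (V(G) \ J)} := fun H hH => htree.eq_of_isComponentOf hH
    refine (Set.encard_le_encard h4).trans ?_
    rw [Set.encard_singleton]
    norm_num

end Graph

theorem theorem5p3 {α β : Type*} (G : Graph α β)
    (hV : G.vertexSet.Finite) (hE : G.edgeSet.Finite)
    (hcubic : G.IsCubic) (hconn : G.IsCyclicallyEdgeConnected 4) :
    ∃ A J : Set α, G.IsCoherentDecyclingPartition A J ∧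
      (G.IsIndependent J ↔ G.vertexSet.ncard ≡ 2 [MOD 4]) ∧
      (G.IsNearIndependent J ↔ G.vertexSet.ncard ≡ 0 [MOD 4]) := by
  classical
  have hloop := hconn.not_isLoopAt hV hE hcubic
  have hT := hconn.isCubicOn_looplessPart hV hE hcubic
  have hne : hV.toFinset.Nonempty := hV.toFinset_nonempty.2 hconn.1.1
  have heven := hT.three_mul_card_self
  obtain ⟨J, hJ, hJconn, hin, hJcard, h⟩ : ∃ J ⊆ hV.toFinset,
      (G.looplessPart hV hE).ConnectedOn (hV.toFinset \ J) ∧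
      #((G.looplessPart hV hE).inside J) ≤ 1 ∧
      4 * #J = #hV.toFinset + 2 + 2 * #((G.looplessPart hV hE).inside J) ∧
      ((#((G.looplessPart hV hE).inside J) = 0 ∧ #hV.toFinset % 4 = 2) ∨
        (#((G.looplessPart hV hE).inside J) = 1 ∧ #hV.toFinset % 4 = 0)) := by
    by_cases hmod : #hV.toFinset % 4 = 2
    · obtain ⟨J, hJ, h1, h2, h3⟩ := hT.exists_connectedOn_of_mod_eq_two hmod
      exact ⟨J, hJ, h1, by omega, by omega, Or.inl ⟨h2, hmod⟩⟩
    · have hmod' : #hV.toFinset % 4 = 0 := by omega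
      obtain ⟨J, hJ, h1, h2, h3⟩ := hT.exists_connectedOn_of_mod_eq_zero hmod' hne
      exact ⟨J, hJ, h1, by omega, by omega, Or.inr ⟨h2, hmod'⟩⟩
  refine ⟨_, J, Graph.isCoherentDecyclingPartition_of_connectedOn hT hloop hJ hJconn hin hJcard, ?_⟩
  rw [Graph.IsIndependent, Graph.IsNearIndependent,
    Graph.edgeSet_induce_eq_inside (hV := hV) (hE := hE) hloop,
    Set.encard_coe_eq_coe_finsetCard, Finset.coe_eq_empty, ← Finset.card_eq_zero,
    Nat.cast_eq_one, Set.ncard_eq_toFinset_card _ hV, Nat.ModEq, Nat.ModEq]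
  omega
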